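/- For $d\in\mathbb N$, a $d$-dimensional VASS-MDP $S=\langle Q,Q_1,Q_P,T,\tau\rangle$ consists of a finite set $Q$ of control states partitioned into $Q_1$ (states of Player 1) and $Q_P$ (probabilistic states), a finite set $T\subseteq Q\times\mathbb Z^d\times Q$ of transitions, and a function $\tau$ assigning a positive integer weight to every transition; transitions leaving states of either kind may change the counters. Configurations are pairs $(q,v)\in Q\times\mathbb N^d$. A transition $(q,z,q')\in T$ is enabled at $(q,v)$ if $v+z\ge 0$ componentwise, and then leads to $(q',v+z)$. A configuration at which no transition is enabled is a deadlock. At a non-deadlocked configuration with control state in $Q_P$, an enabled transition is taken with probability proportional to its weight; at one with control state in $Q_1$, the successor configuration is chosen by Player 1 through a strategy $\sigma$, which is a function of the whole finite play so far. A maximal play is an infinite play, or a finite play that ends in a deadlock. An initial configuration $c_0$ and a strategy $\sigma$ determine the set of maximal plays from $c_0$ that respect $\sigma$ (at probabilistic configurations, every enabled transition is allowed) and a probability measure $\mathbb P_{c_0,\sigma}$ on maximal plays. For a control state $q_F$, the reachability objective $\Diamond q_F$ is the set of maximal plays that visit a configuration with control state $q_F$, and the repeated reachability objective $\Box\Diamond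 q_F$ is the set of infinite plays that do so infinitely often. Given $S$, $c_0$, $q_F$ and an objective $A\in\{\Diamond q_F,\Box\Diamond q_F\}$, the sure problem asks whether there is a strategy $\sigma$ such that all maximal plays from $c_0$ that respect $\sigma$ belong to $A$; the almost-sure problem asks whether there is a strategy $\sigma$ with $\mathbb P_{c_0,\sigma}(A)=1$; the limit-sure problem asks whether $\sup_\sigma\mathbb P_{c_0,\sigma}(A)=1$. **Theorem.** For general VASS-MDPs (the dimension being part of the input), the sure and the almost-sure reachability problems are undecidable, and so are the limit-sure reachability problem and the sure, almost-sure and limit-sure repeated reachability problems. All six problems are undecidable already for $2$-dimensional VASS-MDPs. -/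

import Mathlib

open MeasureTheory ProbabilityTheory

/-! ### Markov decision processes, strategies, plays -/

/-- A Markov decision process on the set `C` of configurations. The configurations of Player 1
are those in `player1`, those of the probabilistic player are the others. `Step` is the transition
relation; `prob` gives the distribution of the next configuration at every probabilistic
configuration that is not a deadlock, and it charges exactly the successors. -/
structure MDP (C : Type) where
  player1 : Set C
  Step : C → C → Prop
  prob : {c : C // c ∉ player1 ∧ ∃ c', Step c c'} → PMF C
  prob_ne_zero_iff : ∀ c c', prob c c' ≠ 0 ↔ Step c.1 c'

namespace MDP

variable {C : Type} (M : MDP C)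

/-- A configuration without successors. -/
def Deadlock (c : C) : Prop := ¬ ∃ c', M.Step c c'

/-- Finite plays: nonempty finite sequences of configurations that follow the transitions. -/
def IsFinitePlay (ρ : List C) : Prop := ρ ≠ [] ∧ ρ.IsChain M.Step

/-- A (history-dependent, deterministic) strategy of Player 1: it chooses a successor after every
finite play `h ++ [c]` that ends in a configuration `c` of Player 1 that is not a deadlock. Values
of `choose` on other lists are irrelevant. -/
structure Strategy where
  choose : List C → C
  step_choose : ∀ (h : List C) (c : C), M.IsFinitePlay (h ++ [c]) → c ∈ M.player1 →
    ¬ M.Deadlock c → M.Step c (choose (h ++ [c]))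

/-- A sequence `ω : ℕ → Option C` encodes a finite or infinite play; `ω n = none` means that the
play has ended before time `n`. `history ω n` lists the configurations of `ω` at times `0, …, n`. -/
def history (ω : ℕ → Option C) (n : ℕ) : List C :=
  (List.ofFn fun i : Fin (n + 1) => ω i).reduceOption

/-- Maximal plays from `c`: infinite plays, and finite plays that end in a deadlock. -/
def IsMaximalPlayFrom (c : C) (ω : ℕ → Option C) : Prop :=
  ω 0 = some c ∧ ∀ n,
    (ω n = none ∧ ω (n + 1) = none) ∨
    (∃ a, ω n = some a ∧ M.Deadlock a ∧ ω (n + 1) = none) ∨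
    (∃ a b, ω n = some a ∧ M.Step a b ∧ ω (n + 1) = some b)

/-- The play `ω` follows the choices of `σ`. -/
def Respects {M : MDP C} (σ : M.Strategy) (ω : ℕ → Option C) : Prop :=
  ∀ n a, ω n = some a → a ∈ M.player1 → ¬ M.Deadlock a →
    ω (n + 1) = some (σ.choose (history ω n))

/-- The maximal plays from `c` that respect `σ`. -/
def plays {M : MDP C} (σ : M.Strategy) (c : C) : Set (ℕ → Option C) :=
  {ω | M.IsMaximalPlayFrom c ω ∧ Respects σ ω}

open Classical in
/-- The distribution of the next entry of the play after the configurations listed in `h`, when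
Player 1 uses `σ`: the play ends at deadlocks, Player 1 moves by `σ`, and at probabilistic
configurations the next configuration is drawn from `prob`. -/
noncomputable def next {M : MDP C} (σ : M.Strategy) (h : List C) : PMF (Option C) :=
  match h.getLast? with
  | none => PMF.pure none
  | some c =>
    if hd : ∃ c', M.Step c c' then
      if h1 : c ∈ M.player1 then PMF.pure (some (σ.choose h))
      else (M.prob ⟨c, h1, hd⟩).map some
    else PMF.pure none

instance optionMeasurableSpace : MeasurableSpace (Option C) := ⊤

instance optionDiscreteMeasurableSpace : DiscreteMeasurableSpace (Option C) := ⟨fun _ => trivial⟩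

/-- The configurations recorded by the entries of a play at times `0, …, n`. -/
def historyUpTo (n : ℕ) (x : (i : Finset.Iic n) → Option C) : List C :=
  (List.ofFn fun i : Fin (n + 1) => x ⟨i, Finset.mem_Iic.2 (Nat.lt_succ_iff.1 i.2)⟩).reduceOption

/-- `next`, as a family of Markov kernels from the past to the next entry. -/
noncomputable def nextKernel [Countable C] {M : MDP C} (σ : M.Strategy) (n : ℕ) :
    Kernel ((_ : Finset.Iic n) → Option C) (Option C) :=
  Kernel.ofFunOfCountable fun x => (next σ (historyUpTo n x)).toMeasure

instance [Countable C] {M : MDP C} (σ : M.Strategy) (n : ℕ) :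
    IsMarkovKernel (nextKernel σ n) :=
  ⟨fun x => by
    change IsProbabilityMeasure (next σ (historyUpTo n x)).toMeasure
    infer_instance⟩

/-- The law of the play that starts in `c` when Player 1 uses `σ` (Ionescu-Tulcea). -/
noncomputable def playMeasure [Countable C] {M : MDP C} (σ : M.Strategy) (c : C) :
    Measure (ℕ → Option C) :=
  Kernel.traj (X := fun _ => Option C) (fun n => nextKernel σ n) 0 (fun _ => some c)

/-- Plays that visit the set `F` of configurations. -/
def reach (F : Set C) : Set (ℕ → Option C) := {ω | ∃ n, ∃ c ∈ F, ω n = some c}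

/-- Plays (necessarily infinite) that visit the set `F` of configurations infinitely often. -/
def repeatedReach (F : Set C) : Set (ℕ → Option C) := {ω | ∀ m, ∃ n ≥ m, ∃ c ∈ F, ω n = some c}

/-- Player 1 has a strategy all of whose maximal plays from `c` satisfy the objective `A`. -/
def Surely (c : C) (A : Set (ℕ → Option C)) : Prop :=
  ∃ σ : M.Strategy, plays σ c ⊆ A

/-- Player 1 has a strategy that achieves the objective `A` from `c` with probability one. -/
def AlmostSurely [Countable C] (c : C) (A : Set (ℕ → Option C)) : Prop :=
  ∃ σ : M.Strategy, playMeasure σ c A = 1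

/-- The supremum over all strategies of the probability of the objective `A` from `c` is one. -/
def LimitSurely [Countable C] (c : C) (A : Set (ℕ → Option C)) : Prop :=
  ⨆ σ : M.Strategy, playMeasure σ c A = 1

end MDP

/-! ### VASS-MDPs -/

/-- Transitions `(q, z, q')` of a `d`-dimensional VASS with control states in `Q`. -/
abbrev VASSTransition (d : ℕ) (Q : Type) := Q × (Fin d → ℤ) × Q

/-- A `d`-dimensional VASS-MDP with control states `Q`: the control states in `Q1` belong to
Player 1, the others to the probabilistic player; `T` is the finite set of transitions, and `τ`
gives every transition a positive weight (used only at probabilistic control states). Transitions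
of either player may change the counters. -/
structure VASSMDP (d : ℕ) (Q : Type) where
  Q1 : Set Q
  T : Finset (VASSTransition d Q)
  τ : {t // t ∈ T} → ℕ+

/-- Configurations: a control state and the values of the counters. -/
abbrev VASSConfig (d : ℕ) (Q : Type) := Q × (Fin d → ℕ)

namespace VASSMDP

variable {d : ℕ} {Q : Type} (S : VASSMDP d Q)

/-- `t` is enabled at `c`: it starts in the control state of `c` and no counter gets negative. -/
def Enabled (t : VASSTransition d Q) (c : VASSConfig d Q) : Prop :=
  t.1 = c.1 ∧ ∀ i, 0 ≤ (c.2 i : ℤ) + t.2.1 i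

/-- The configuration reached from `c` by a transition `t` that is enabled at `c`. -/
def fire (t : VASSTransition d Q) (c : VASSConfig d Q) : VASSConfig d Q :=
  (t.2.2, fun i => ((c.2 i : ℤ) + t.2.1 i).toNat)

def Step (c c' : VASSConfig d Q) : Prop := ∃ t ∈ S.T, Enabled t c ∧ fire t c = c'

open Classical in
/-- The transitions of `S` that are enabled at `c`. -/
noncomputable def enabled (c : VASSConfig d Q) : Finset {t // t ∈ S.T} :=
  S.T.attach.filter fun t => Enabled t.1 c

open Classical in
/-- The probability of moving from `c` to `c'`: the sum of the weights of the enabled transitions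
that lead from `c` to `c'`, divided by the sum of the weights of all enabled transitions. -/
noncomputable def stepProb (c c' : VASSConfig d Q) : ENNReal :=
  (∑ t ∈ (S.enabled c).filter (fun t => fire t.1 c = c'), ((S.τ t : ℕ) : ENNReal)) /
    ∑ t ∈ S.enabled c, ((S.τ t : ℕ) : ENNReal)

theorem mem_enabled {c : VASSConfig d Q} {t : {t // t ∈ S.T}} :
    t ∈ S.enabled c ↔ Enabled t.1 c := by
  classical
  simp [enabled]

theorem sum_enabled_ne_zero {c : VASSConfig d Q} (h : ∃ c', S.Step c c') :
    ∑ t ∈ S.enabled c, ((S.τ t : ℕ) : ENNReal) ≠ 0 := by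
  obtain ⟨_, t, ht, he, _⟩ := h
  intro h0
  have := (Finset.sum_eq_zero_iff.1 h0) ⟨t, ht⟩ (S.mem_enabled.2 he)
  simp at this

theorem sum_enabled_ne_top (c : VASSConfig d Q) :
    ∑ t ∈ S.enabled c, ((S.τ t : ℕ) : ENNReal) ≠ ⊤ :=
  ENNReal.sum_ne_top.2 fun _ _ => ENNReal.natCast_ne_top _

theorem hasSum_stepProb {c : VASSConfig d Q} (h : ∃ c', S.Step c c') :
    HasSum (S.stepProb c) 1 := by
  classical
  have key : ∑' c', S.stepProb c c' = 1 := by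
    simp only [stepProb, div_eq_mul_inv]
    rw [ENNReal.tsum_mul_right]
    have : ∑' c', ∑ t ∈ (S.enabled c).filter (fun t => fire t.1 c = c'),
        ((S.τ t : ℕ) : ENNReal) = ∑ t ∈ S.enabled c, ((S.τ t : ℕ) : ENNReal) := by
      simp only [Finset.sum_filter]
      rw [Summable.tsum_finsetSum fun _ _ => ENNReal.summable]
      refine Finset.sum_congr rfl fun t _ => ?_
      rw [tsum_eq_single (fire t.1 c) fun b hb => if_neg (Ne.symm hb), if_pos rfl]
    rw [this]
    exact ENNReal.mul_inv_cancel (S.sum_enabled_ne_zero h) (S.sum_enabled_ne_top c)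
  exact key ▸ ENNReal.summable.hasSum

theorem stepProb_ne_zero_iff (c c' : VASSConfig d Q) : S.stepProb c c' ≠ 0 ↔ S.Step c c' := by
  classical
  rw [stepProb, Ne, ENNReal.div_eq_zero_iff, not_or]
  constructor
  · rintro ⟨h, -⟩
    obtain ⟨t, ht, -⟩ := Finset.exists_ne_zero_of_sum_ne_zero h
    rw [Finset.mem_filter, mem_enabled] at ht
    exact ⟨t.1, t.2, ht.1, ht.2⟩
  · rintro ⟨t, ht, he, hf⟩
    refine ⟨fun h0 => ?_, S.sum_enabled_ne_top c⟩
    have := (Finset.sum_eq_zero_iff.1 h0) ⟨t, ht⟩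
      (Finset.mem_filter.2 ⟨S.mem_enabled.2 he, hf⟩)
    simp at this

/-- The MDP induced by a VASS-MDP. -/
noncomputable def toMDP : MDP (VASSConfig d Q) where
  player1 := {c | c.1 ∈ S.Q1}
  Step := S.Step
  prob c := ⟨S.stepProb c.1, S.hasSum_stepProb c.2.2⟩
  prob_ne_zero_iff c c' := S.stepProb_ne_zero_iff c.1 c'

end VASSMDP

/-! ### The decision problems -/

/-- An input of the verification problems in dimension `d`: a VASS-MDP whose finite nonempty set of
control states is `{0, …, k}`, an initial configuration and a target control state. -/
structure VASSInput (d : ℕ) where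
  k : ℕ
  S : VASSMDP d (Fin (k + 1))
  init : VASSConfig d (Fin (k + 1))
  target : Fin (k + 1)

namespace VASSInput

variable {d : ℕ}

/-- The configurations whose control state is the target. -/
def targetSet (I : VASSInput d) : Set (VASSConfig d (Fin (I.k + 1))) := {c | c.1 = I.target}

def SureReachability (I : VASSInput d) : Prop :=
  I.S.toMDP.Surely I.init (MDP.reach I.targetSet)

def AlmostSureReachability (I : VASSInput d) : Prop :=
  I.S.toMDP.AlmostSurely I.init (MDP.reach I.targetSet)

def LimitSureReachability (I : VASSInput d) : Prop :=
  I.S.toMDP.LimitSurely I.init (MDP.reach I.targetSet)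

def SureRepeatedReachability (I : VASSInput d) : Prop :=
  I.S.toMDP.Surely I.init (MDP.repeatedReach I.targetSet)

def AlmostSureRepeatedReachability (I : VASSInput d) : Prop :=
  I.S.toMDP.AlmostSurely I.init (MDP.repeatedReach I.targetSet)

def LimitSureRepeatedReachability (I : VASSInput d) : Prop :=
  I.S.toMDP.LimitSurely I.init (MDP.repeatedReach I.targetSet)

end VASSInput

/-- Finite descriptions of inputs:
`(k, owners, transitions, (initial state, initial counter values), target)`, where each entry
`((q, z, q'), w)` of the list of transitions stands for the transition `(q, z, q')` with weight
`w + 1`. -/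
abbrev VASSCode :=
  ℕ × List Bool × List ((ℕ × List ℤ × ℕ) × ℕ) × (ℕ × List ℕ) × ℕ

namespace VASSCode

/-- The list of weighted transitions that is described by a list of entries, with control states
`{0, …, k}` in dimension `d`. Control states are read modulo `k + 1`, vectors are cut or padded
with zeros to length `d`. -/
def entries (d k : ℕ) (L : List ((ℕ × List ℤ × ℕ) × ℕ)) :
    List (VASSTransition d (Fin (k + 1)) × ℕ+) :=
  L.map fun e =>
    ((Fin.ofNat (k + 1) e.1.1, fun i => e.1.2.1.getD i 0, Fin.ofNat (k + 1) e.1.2.2),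
      e.2.succPNat)

/-- The total weight that a list of weighted transitions gives to `t`. -/
def totalWeight {α : Type} [DecidableEq α] (L : List (α × ℕ+)) (t : α) : ℕ :=
  ((L.filter fun e => e.1 = t).map fun e => (e.2 : ℕ)).sum

theorem totalWeight_pos {α : Type} [DecidableEq α] {L : List (α × ℕ+)} {t : α}
    (h : t ∈ (L.map Prod.fst).toFinset) : 0 < totalWeight L t := by
  simp only [List.mem_toFinset, List.mem_map] at h
  obtain ⟨e, he, rfl⟩ := h
  refine lt_of_lt_of_le e.2.pos (List.single_le_sum (fun _ _ => Nat.zero_le _) _ ?_)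
  exact List.mem_map.2 ⟨e, List.mem_filter.2 ⟨he, by simp⟩, rfl⟩

/-- The VASS-MDP given by a set of control states of Player 1 and a list of weighted transitions
(the weights of repeated transitions are added). -/
def ofList {d : ℕ} {Q : Type} [DecidableEq Q] (Q1 : Set Q) (L : List (VASSTransition d Q × ℕ+)) :
    VASSMDP d Q where
  Q1 := Q1
  T := (L.map Prod.fst).toFinset
  τ t := ⟨totalWeight L t.1, totalWeight_pos t.2⟩

/-- The input of dimension `d` that is described by a code. Every input is described by some code
(`decode_surjective`). -/
def decode (d : ℕ) : VASSCode → VASSInput d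
  | (k, owners, L, (q, v), f) =>
    { k := k
      S := ofList {q | owners.getD q false = true} (entries d k L)
      init := (Fin.ofNat (k + 1) q, fun i => v.getD i 0)
      target := Fin.ofNat (k + 1) f }

theorem decode_surjective (d : ℕ) : Function.Surjective (decode d) := by
  classical
  rintro ⟨k, ⟨Q1, T, τ⟩, ⟨q, v⟩, f⟩
  have hget : ∀ {α : Type} (a : α) {n : ℕ} (g : Fin n → α) (i : Fin n),
      (List.ofFn g).getD i a = g i := by
    intro α a n g i
    simp [List.getD_eq_getElem?_getD]
  have hof : ∀ x : Fin (k + 1), Fin.ofNat (k + 1) x = x := by simp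
  have hL : entries d k (T.attach.toList.map fun t =>
      (((t.1.1 : ℕ), List.ofFn t.1.2.1, (t.1.2.2 : ℕ)), (τ t : ℕ) - 1)) =
      T.attach.toList.map fun t => (t.1, τ t) := by
    rw [entries, List.map_map]
    refine List.map_congr_left fun t _ => ?_
    simp only [Function.comp, hof, hget]
    refine Prod.ext rfl (PNat.eq ?_)
    have := (τ t).pos
    simp only [Nat.succPNat_coe]
    omega
  refine ⟨(k, List.ofFn fun i : Fin (k + 1) => decide (i ∈ Q1),
    T.attach.toList.map fun t =>
      (((t.1.1 : ℕ), List.ofFn t.1.2.1, (t.1.2.2 : ℕ)), (τ t : ℕ) - 1),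
    ((q : ℕ), List.ofFn v), (f : ℕ)), ?_⟩
  have hS : ∀ (S S' : VASSMDP d (Fin (k + 1))), S.Q1 = S'.Q1 → ∀ hT : S.T = S'.T,
      (∀ t (h : t ∈ S.T), S.τ ⟨t, h⟩ = S'.τ ⟨t, hT ▸ h⟩) → S = S' := by
    rintro ⟨a, b, c⟩ ⟨a', b', c'⟩ h1 h2 h3
    simp only at h1 h2
    subst h1 h2
    congr 1
    exact funext fun t => h3 t.1 t.2
  simp only [decode, hof, hget, hL]
  congr 1
  refine hS _ _ ?_ ?_ ?_
  · ext x
    simp [ofList]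
  · ext x
    simp [ofList]
  · intro t h
    have ht : t ∈ T := by simpa [ofList] using h
    refine PNat.eq ?_
    change totalWeight _ t = (τ ⟨t, ht⟩ : ℕ)
    rw [totalWeight, List.filter_map, List.map_map]
    have : T.attach.toList.filter ((fun e : VASSTransition d (Fin (k + 1)) × ℕ+ =>
        decide (e.1 = t)) ∘ fun t => (t.1, τ t)) = [⟨t, ht⟩] := by
      have h1 : T.attach.toList.filter ((fun e : VASSTransition d (Fin (k + 1)) × ℕ+ =>
          decide (e.1 = t)) ∘ fun t => (t.1, τ t)) =
          T.attach.toList.filter (fun x => x = ⟨t, ht⟩) :=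
        List.filter_congr fun x _ => by simp [Subtype.ext_iff]
      rw [h1, List.filter_eq, List.count_eq_one_of_mem (Finset.nodup_toList _) (by simp)]
      rfl
    rw [this]
    simp

end VASSCode

/-- The decision problem `P` for VASS-MDPs of dimension `d` is undecidable. -/
def UndecidableInDim (d : ℕ) (P : VASSInput d → Prop) : Prop :=
  ¬ ComputablePred fun c : VASSCode => P (VASSCode.decode d c)

/-- The decision problem `P` for VASS-MDPs of arbitrary dimension, where the dimension is a part of
the input, is undecidable. -/
def UndecidableVASSProblem (P : ∀ d, VASSInput d → Prop) : Prop :=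
  ¬ ComputablePred fun x : ℕ × VASSCode => P x.1 (VASSCode.decode x.1 x.2)

/-!
The halting problem for a partial recursive function is simulated by two counters. A stack machine
computes the function; its stacks are read as numbers in base `card Γ + 1`, so that pushing and
popping are affine maps of counters. Any number of counters is compressed into one, together with
a scratch counter, by taking a product of prime powers. Counter programs are regular expressions
over the instructions, so a finite automaton can drive them.

In the resulting VASS-MDP, Player 1 chooses the run. A zero test is a claim of Player 1, after which
the probabilistic player either lets the play go on or decrements the tested counter and moves to a
deadlock, which is possible only when the claim is false. If some honest run accepts, then following
it and looping at the target wins repeated reachability surely. Otherwise Player 1 has to make a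
false claim before reaching the target, and each such claim loses with probability at least
`1 / |T|`, uniformly in the strategy. Every one of the six problems lies between sure repeated
reachability and limit-sure reachability, so the same reduction works for all of them.
-/

theorem exists_path_of_reflTransGen {α : Type*} {r : α → α → Prop} {a b : α}
    (h : Relation.ReflTransGen r a b) (hb : r b b) :
    ∃ w : ℕ → α, w 0 = a ∧ (∀ n, r (w n) (w (n + 1))) ∧ ∃ N, ∀ n ≥ N, w n = b := by
  induction h using Relation.ReflTransGen.head_induction_on with
  | refl => exact ⟨fun _ => b, rfl, fun _ => hb, 0, fun _ _ => rfl⟩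
  | @head a c h _ ih =>
    obtain ⟨w, rfl, hw, N, hN⟩ := ih
    refine ⟨fun n => Nat.casesOn n a w, rfl, fun n => ?_, N + 1, fun n hn => ?_⟩
    · cases n with
      | zero => exact h
      | succ n => exact hw n
    · cases n with
      | zero => lia
      | succ n => exact hN n (by lia)

namespace MDP

variable {C : Type} {M : MDP C}

theorem history_zero (ω : ℕ → Option C) : history ω 0 = (ω 0).toList := by
  cases h : ω 0 <;> simp [history, h, List.reduceOption]

theorem history_succ (ω : ℕ → Option C) (n : ℕ) :
    history ω (n + 1) = history ω n ++ (ω (n + 1)).toList := by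
  have : (List.ofFn fun i : Fin (n + 1 + 1) => ω i) =
      (List.ofFn fun i : Fin (n + 1) => ω i) ++ [ω (n + 1)] := by
    rw [List.ofFn_succ']
    simp
  rw [history, this, List.reduceOption_append, history]
  cases h : ω (n + 1) <;> simp [List.reduceOption]

theorem history_eq_historyUpTo (ω : ℕ → Option C) (n : ℕ) :
    history ω n = historyUpTo n (Preorder.frestrictLe n ω) := rfl

theorem next_append_of_deadlock (σ : M.Strategy) (h : List C) {a : C} (ha : M.Deadlock a) :
    next σ (h ++ [a]) = PMF.pure none := by
  simp only [next, List.getLast?_append, List.getLast?_singleton, Option.some_or]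
  rw [dif_neg ha]

theorem next_append_of_player1 (σ : M.Strategy) (h : List C) {a : C} (ha : ¬ M.Deadlock a)
    (h1 : a ∈ M.player1) : next σ (h ++ [a]) = PMF.pure (some (σ.choose (h ++ [a]))) := by
  simp only [next, List.getLast?_append, List.getLast?_singleton, Option.some_or]
  rw [dif_pos (not_not.1 ha), dif_pos h1]

theorem next_append_of_not_player1 (σ : M.Strategy) (h : List C) {a : C}
    (ha : a ∉ M.player1 ∧ ∃ c', M.Step a c') :
    next σ (h ++ [a]) = (M.prob ⟨a, ha⟩).map some := by
  simp only [next, List.getLast?_append, List.getLast?_singleton, Option.some_or]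
  rw [dif_pos ha.2, dif_neg ha.1]

theorem mem_support_next (σ : M.Strategy) {h : List C} {a : C} {o : Option C}
    (hp : M.IsFinitePlay (h ++ [a])) (ho : o ∈ (next σ (h ++ [a])).support) :
    (M.Deadlock a ∧ o = none) ∨
      ∃ b, M.Step a b ∧ o = some b ∧ (a ∈ M.player1 → b = σ.choose (h ++ [a])) := by
  by_cases hd : M.Deadlock a
  · rw [next_append_of_deadlock σ h hd] at ho
    exact Or.inl ⟨hd, by simpa using ho⟩
  right
  by_cases h1 : a ∈ M.player1
  · rw [next_append_of_player1 σ h hd h1] at ho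
    exact ⟨_, σ.step_choose h a hp h1 hd, by simpa using ho, fun _ => rfl⟩
  · rw [next_append_of_not_player1 σ h ⟨h1, not_not.1 hd⟩] at ho
    obtain ⟨b, hb, hb'⟩ := (PMF.mem_support_map_iff _ _ _).1 ho
    exact ⟨b, (M.prob_ne_zero_iff _ _).1 hb, hb'.symm, fun h => absurd h h1⟩

theorem exists_history_eq_append (σ : M.Strategy) {c : C} {ω : ℕ → Option C} (h0 : ω 0 = some c)
    (hω : ∀ n, ω (n + 1) ∈ (next σ (history ω n)).support) (n : ℕ) :
    ∃ h a, history ω n = h ++ [a] ∧ M.IsFinitePlay (h ++ [a]) ∧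
      (ω n = some a ∨ ω n = none ∧ M.Deadlock a) := by
  induction n with
  | zero => exact ⟨[], c, by simp [history_zero, h0], by simp [IsFinitePlay], Or.inl h0⟩
  | succ n ih =>
    obtain ⟨h, a, hh, hp, -⟩ := ih
    rcases mem_support_next σ hp (hh ▸ hω n) with ⟨hd, hn⟩ | ⟨b, hs, hn, -⟩
    · exact ⟨h, a, by simp [history_succ, hn, hh], hp, Or.inr ⟨hn, hd⟩⟩
    · refine ⟨h ++ [a], b, by simp [history_succ, hn, hh], ⟨by simp, ?_⟩, Or.inl hn⟩
      exact List.isChain_append.2 ⟨hp.2, by simp, by simpa using hs⟩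

theorem mem_plays_of_mem_support (σ : M.Strategy) {c : C} {ω : ℕ → Option C} (h0 : ω 0 = some c)
    (hω : ∀ n, ω (n + 1) ∈ (next σ (history ω n)).support) : ω ∈ plays σ c := by
  refine ⟨⟨h0, fun n => ?_⟩, fun n a ha h1 hd => ?_⟩
  · obtain ⟨h, a, hh, hp, hn⟩ := exists_history_eq_append σ h0 hω n
    rcases mem_support_next σ hp (hh ▸ hω n), hn with
      ⟨⟨hd, hs⟩ | ⟨b, hs, hb, -⟩, hn | ⟨hn, hd'⟩⟩
    · exact Or.inr (Or.inl ⟨a, hn, hd, hs⟩)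
    · exact Or.inl ⟨hn, hs⟩
    · exact Or.inr (Or.inr ⟨a, b, hn, hs, hb⟩)
    · exact absurd ⟨b, hs⟩ hd'
  · obtain ⟨h, a', hh, hp, hn | ⟨hn, -⟩⟩ := exists_history_eq_append σ h0 hω n
    · obtain rfl : a' = a := by simpa [hn] using ha
      rcases mem_support_next σ hp (hh ▸ hω n) with ⟨hd', -⟩ | ⟨b, -, hb, hb'⟩
      · exact absurd hd' hd
      · rw [hb, hh, hb' h1]
    · simp [hn] at ha

theorem IsMaximalPlayFrom.eq_none_of_le {c : C} {ω : ℕ → Option C} (hω : M.IsMaximalPlayFrom c ω)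
    {m n : ℕ} (hmn : m ≤ n) (hm : ω m = none) : ω n = none := by
  induction n, hmn using Nat.le_induction with
  | base => exact hm
  | succ n _ ih =>
    rcases hω.2 n with h | ⟨a, h, -⟩ | ⟨a, b, h, -⟩
    · exact h.2
    · simp [ih] at h
    · simp [ih] at h

theorem IsMaximalPlayFrom.eq_none_of_deadlock {c : C} {ω : ℕ → Option C}
    (hω : M.IsMaximalPlayFrom c ω) {m n : ℕ} (hmn : m < n) {a : C} (hm : ω m = some a)
    (ha : M.Deadlock a) : ω n = none := by
  refine hω.eq_none_of_le hmn ?_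
  rcases hω.2 m with h | ⟨_, -, -, h⟩ | ⟨a', b, h, hs, -⟩
  · exact h.2
  · exact h
  · obtain rfl : a = a' := by simpa [hm] using h
    exact absurd ⟨b, hs⟩ ha

theorem IsMaximalPlayFrom.step {c : C} {ω : ℕ → Option C} (hω : M.IsMaximalPlayFrom c ω)
    {n : ℕ} {a : C} (hn : ω n = some a) (hd : ¬ M.Deadlock a) :
    ∃ b, M.Step a b ∧ ω (n + 1) = some b := by
  rcases hω.2 n with h | ⟨a', h, hd', -⟩ | ⟨a', b, h, hs, hb⟩
  · simp [hn] at h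
  · obtain rfl : a = a' := by simpa [hn] using h
    exact absurd hd' hd
  · obtain rfl : a = a' := by simpa [hn] using h
    exact ⟨b, hs, hb⟩

theorem repeatedReach_subset_reach (F : Set C) : repeatedReach F ⊆ reach F := fun _ h =>
  let ⟨n, _, h⟩ := h 0
  ⟨n, h⟩

theorem Surely.mono {c : C} {A B : Set (ℕ → Option C)} (hAB : A ⊆ B)
    (h : M.Surely c A) : M.Surely c B := by
  obtain ⟨σ, hσ⟩ := h
  exact ⟨σ, hσ.trans hAB⟩

/-- The plays that stay in `good` before time `n` and are in `bad` at time `n`. -/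
def leaveAt (good bad : Set C) (n : ℕ) : Set (ℕ → Option C) :=
  {ω | (∀ i < n, ∃ a ∈ good, ω i = some a) ∧ ∃ a ∈ bad, ω n = some a}

theorem IsMaximalPlayFrom.exists_mem_leaveAt {good bad : Set C} {c : C} {ω : ℕ → Option C}
    (hω : M.IsMaximalPlayFrom c ω) (hgood : ∀ a ∈ good, ∀ b, M.Step a b → b ∈ good ∪ bad)
    (hc : c ∈ good) {N : ℕ} {f : C} (hN : ω N = some f) (hf : f ∉ good) :
    ∃ n ≤ N, ω ∈ leaveAt good bad n := by
  classical
  have hN' : ¬ ∃ a ∈ good, ω N = some a := by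
    rintro ⟨a, ha, ha'⟩
    obtain rfl : f = a := by simpa [hN] using ha'
    exact hf ha
  have hex : ∃ n, ¬ ∃ a ∈ good, ω n = some a := ⟨N, hN'⟩
  have hle : Nat.find hex ≤ N := Nat.find_le hN'
  have hmin : ∀ i < Nat.find hex, ∃ a ∈ good, ω i = some a := fun i hi =>
    not_not.1 (Nat.find_min hex hi)
  refine ⟨_, hle, hmin, ?_⟩
  have hleft := Nat.find_spec hex
  cases hn : Nat.find hex with
  | zero => exact absurd ⟨c, hc, hω.1⟩ (hn ▸ hleft)
  | succ n =>
    rw [hn] at hle hleft hmin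
    obtain ⟨a, ha, ha'⟩ := hmin n n.lt_succ_self
    have hd : ¬ M.Deadlock a := fun hd => by
      simp [hω.eq_none_of_deadlock hle ha' hd] at hN
    obtain ⟨b, hs, hb⟩ := hω.step ha' hd
    exact ⟨b, (hgood a ha b hs).resolve_left fun h => hleft ⟨b, h, hb⟩, hb⟩

theorem IsMaximalPlayFrom.notMem_trap_of_mem_leaveAt {good bad trap F : Set C} {c : C}
    {ω : ℕ → Option C} (hω : M.IsMaximalPlayFrom c ω) (htrap : ∀ t ∈ trap, M.Deadlock t)
    (hbF : Disjoint bad F) (htF : Disjoint trap F) {n N : ℕ} (hn : ω ∈ leaveAt good bad n)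
    (hnN : n ≤ N) {f : C} (hN : ω N = some f) (hf : f ∈ F) : ω (n + 1) ∉ some '' trap := by
  rintro ⟨t, ht, ht'⟩
  obtain ⟨b, hb, hb'⟩ := hn.2
  obtain rfl | rfl | h : N = n ∨ N = n + 1 ∨ n + 1 < N := by lia
  · obtain rfl : f = b := by simpa [hN] using hb'
    exact Set.disjoint_left.1 hbF hb hf
  · obtain rfl : t = f := by simpa [hN] using ht'
    exact Set.disjoint_left.1 htF ht hf
  · simp [hω.eq_none_of_deadlock h ht'.symm (htrap t ht)] at hN

theorem pairwise_disjoint_leaveAt {good bad : Set C} (h : Disjoint good bad) :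
    Pairwise (Function.onFun Disjoint (leaveAt good bad)) := by
  have key : ∀ i j, i < j → Disjoint (leaveAt good bad i) (leaveAt good bad j) := by
    intro i j hij
    refine Set.disjoint_left.2 fun ω hi hj => ?_
    obtain ⟨a, ha, ha'⟩ := hj.1 i hij
    obtain ⟨b, hb, hb'⟩ := hi.2
    obtain rfl : a = b := by simpa [ha'] using hb'
    exact Set.disjoint_left.1 h ha hb
  intro i j hij
  rcases lt_or_gt_of_ne hij with h | h
  · exact key i j h
  · exact (key j i h).symm

/-- The prefixes up to time `n` of the plays in `leaveAt good bad n`. -/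
def leaveAtPrefix (good bad : Set C) (n : ℕ) : Set ((_ : Finset.Iic n) → Option C) :=
  {x | (∀ i (h : i < n), ∃ a ∈ good, x ⟨i, Finset.mem_Iic.2 h.le⟩ = some a) ∧
    ∃ a ∈ bad, x ⟨n, Finset.mem_Iic.2 le_rfl⟩ = some a}

theorem leaveAt_eq_preimage (good bad : Set C) (n : ℕ) :
    leaveAt good bad n =
      Preorder.frestrictLe (π := fun _ => Option C) n ⁻¹' leaveAtPrefix good bad n := rfl

theorem historyUpTo_of_mem_leaveAtPrefix {good bad : Set C} {n : ℕ}
    {x : (_ : Finset.Iic n) → Option C} (hx : x ∈ leaveAtPrefix good bad n) :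
    ∃ h, ∃ a ∈ bad, historyUpTo n x = h ++ [a] := by
  obtain ⟨-, a, ha, hx⟩ := hx
  let ω : ℕ → Option C := fun i => if h : i ≤ n then x ⟨i, Finset.mem_Iic.2 h⟩ else none
  have hω : historyUpTo n x = history ω n := by
    rw [history_eq_historyUpTo]
    congr 1
    ext1 i
    simp [ω, Preorder.frestrictLe, Finset.mem_Iic.1 i.2]
  have hn : ω n = some a := by simp [ω, hx]
  rw [hω]
  cases n with
  | zero => exact ⟨[], a, ha, by simp [history_zero, hn]⟩
  | succ n => exact ⟨_, a, ha, by rw [history_succ, hn]; rfl⟩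

section Measure

variable [Countable C]

instance (σ : M.Strategy) (c : C) : IsProbabilityMeasure (playMeasure σ c) := by
  unfold playMeasure
  infer_instance

theorem map_playMeasure (σ : M.Strategy) (c : C) (n : ℕ) :
    (playMeasure σ c).map (fun ω => (Preorder.frestrictLe (π := fun _ => Option C) n ω, ω (n + 1)))
      = ((playMeasure σ c).map (Preorder.frestrictLe (π := fun _ => Option C) n)) ⊗ₘ
        nextKernel σ n := by
  unfold playMeasure
  rw [Kernel.traj_map_frestrictLe_apply]
  exact (Kernel.partialTraj_compProd_eq_map_traj (X := fun _ => Option C) (Nat.zero_le n)).symm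

theorem ae_zero_playMeasure (σ : M.Strategy) (c : C) :
    ∀ᵐ ω ∂(playMeasure σ c), ω 0 = some c := by
  have h := Kernel.traj_map_frestrictLe_apply (X := fun _ => Option C)
    (κ := fun n => nextKernel σ n) 0 0 (fun _ => some c)
  have h2 : ∀ᵐ x ∂((playMeasure σ c).map (Preorder.frestrictLe (π := fun _ => Option C) 0)),
      x ⟨0, by simp⟩ = some c := by
    unfold playMeasure
    rw [h, Kernel.partialTraj_self, Kernel.id_apply, ae_dirac_eq]
    simp
  exact ae_of_ae_map (by fun_prop) h2

theorem ae_mem_support_playMeasure (σ : M.Strategy) (c : C) (n : ℕ) :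
    ∀ᵐ ω ∂(playMeasure σ c), ω (n + 1) ∈ (next σ (history ω n)).support := by
  have h2 : ∀ᵐ p ∂((playMeasure σ c).map (fun ω =>
      (Preorder.frestrictLe (π := fun _ => Option C) n ω, ω (n + 1)))),
      p.2 ∈ (next σ (historyUpTo n p.1)).support := by
    rw [map_playMeasure]
    refine Measure.ae_compProd_of_ae_ae (.of_discrete) (ae_of_all _ fun x => ?_)
    change ∀ᵐ y ∂((next σ (historyUpTo n x)).toMeasure), y ∈ (next σ (historyUpTo n x)).support
    rw [ae_iff]
    change (next σ (historyUpTo n x)).toMeasure ((next σ (historyUpTo n x)).support)ᶜ = 0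
    rw [PMF.toMeasure_apply_eq_zero_iff _ (.of_discrete)]
    exact disjoint_compl_right
  exact ae_of_ae_map (by fun_prop) h2

theorem ae_mem_plays (σ : M.Strategy) (c : C) : ∀ᵐ ω ∂(playMeasure σ c), ω ∈ plays σ c := by
  filter_upwards [ae_zero_playMeasure σ c, ae_all_iff.2 (ae_mem_support_playMeasure σ c)]
    with ω h0 h using mem_plays_of_mem_support σ h0 h

theorem Surely.almostSurely {c : C} {A : Set (ℕ → Option C)} (h : M.Surely c A) :
    M.AlmostSurely c A := by
  obtain ⟨σ, hσ⟩ := h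
  refine ⟨σ, le_antisymm prob_le_one ?_⟩
  calc (1 : ENNReal) = playMeasure σ c Set.univ := measure_univ.symm
    _ ≤ playMeasure σ c A := measure_mono_ae <| by
      filter_upwards [ae_mem_plays σ c] with ω hω _ using hσ hω

theorem AlmostSurely.limitSurely {c : C} {A : Set (ℕ → Option C)} (h : M.AlmostSurely c A) :
    M.LimitSurely c A := by
  obtain ⟨σ, hσ⟩ := h
  exact le_antisymm (iSup_le fun _ => prob_le_one) (hσ ▸ le_iSup (fun σ => playMeasure σ c A) σ)

theorem LimitSurely.mono {c : C} {A B : Set (ℕ → Option C)} (hAB : A ⊆ B)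
    (h : M.LimitSurely c A) : M.LimitSurely c B :=
  le_antisymm (iSup_le fun _ => prob_le_one)
    (h.symm.le.trans (iSup_mono fun _ => measure_mono hAB))

theorem measurableSet_leaveAt (good bad : Set C) (n : ℕ) :
    MeasurableSet (leaveAt good bad n) := by
  rw [leaveAt_eq_preimage]
  exact (MeasurableSet.of_discrete (s := leaveAtPrefix good bad n)).preimage (by fun_prop)

theorem playMeasure_leaveAt_inter_le {bad trap : Set C} (good : Set C) {δ : ENNReal}
    (hbad : ∀ b ∈ bad, ∃ (hb : b ∉ M.player1 ∧ ∃ c', M.Step b c'), ∃ t ∈ trap,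
      δ ≤ M.prob ⟨b, hb⟩ t) (σ : M.Strategy) (c : C) (n : ℕ) :
    playMeasure σ c (leaveAt good bad n ∩ {ω | ω (n + 1) ∉ some '' trap}) ≤
      (1 - δ) * playMeasure σ c (leaveAt good bad n) := by
  set μ := playMeasure σ c
  have h1 : leaveAt good bad n ∩ {ω | ω (n + 1) ∉ some '' trap} =
      (fun ω => (Preorder.frestrictLe (π := fun _ => Option C) n ω, ω (n + 1))) ⁻¹'
        (leaveAtPrefix good bad n ×ˢ (some '' trap)ᶜ) := rfl
  rw [h1, ← Measure.map_apply (by fun_prop) (.of_discrete), map_playMeasure,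
    Measure.compProd_apply_prod (.of_discrete) (.of_discrete), leaveAt_eq_preimage,
    ← Measure.map_apply (by fun_prop) (.of_discrete), ← setLIntegral_const]
  refine setLIntegral_mono (by fun_prop) fun x hx => ?_
  change (next σ (historyUpTo n x)).toMeasure (some '' trap)ᶜ ≤ 1 - δ
  rw [prob_compl_eq_one_sub (.of_discrete)]
  refine tsub_le_tsub_left ?_ 1
  obtain ⟨h, b, hb, hh⟩ := historyUpTo_of_mem_leaveAtPrefix hx
  obtain ⟨hb', t, ht, hδ⟩ := hbad b hb
  rw [hh, next_append_of_not_player1 σ h hb']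
  calc δ ≤ M.prob ⟨b, hb'⟩ t := hδ
    _ ≤ (M.prob ⟨b, hb'⟩).map some (some t) := by
      rw [PMF.map_apply]
      refine le_of_eq_of_le ?_ (ENNReal.le_tsum t)
      simp
    _ = ((M.prob ⟨b, hb'⟩).map some).toMeasure {some t} :=
      (PMF.toMeasure_apply_singleton _ _ (.of_discrete)).symm
    _ ≤ _ := measure_mono (by simpa using ht)

theorem playMeasure_reach_le {good bad trap F : Set C} {δ : ENNReal}
    (hgood : ∀ a ∈ good, ∀ b, M.Step a b → b ∈ good ∪ bad)
    (hbad : ∀ b ∈ bad, ∃ (hb : b ∉ M.player1 ∧ ∃ c', M.Step b c'), ∃ t ∈ trap,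
      δ ≤ M.prob ⟨b, hb⟩ t)
    (htrap : ∀ t ∈ trap, M.Deadlock t) (hgb : Disjoint good bad)
    (hgF : Disjoint good F) (hbF : Disjoint bad F) (htF : Disjoint trap F)
    (σ : M.Strategy) {c : C} (hc : c ∈ good) :
    playMeasure σ c (reach F) ≤ 1 - δ := by
  set μ := playMeasure σ c
  have hsub : reach F ≤ᵐ[μ] ⋃ n, leaveAt good bad n ∩ {ω | ω (n + 1) ∉ some '' trap} := by
    filter_upwards [ae_mem_plays σ c] with ω hω ⟨N, f, hf, hN⟩
    obtain ⟨n, hnN, hn⟩ :=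
      hω.1.exists_mem_leaveAt hgood hc hN fun h => Set.disjoint_left.1 hgF h hf
    exact Set.mem_iUnion.2
      ⟨n, hn, hω.1.notMem_trap_of_mem_leaveAt htrap hbF htF hn hnN hN hf⟩
  calc μ (reach F) ≤ μ (⋃ n, leaveAt good bad n ∩ {ω | ω (n + 1) ∉ some '' trap}) :=
        measure_mono_ae hsub
    _ ≤ ∑' n, μ (leaveAt good bad n ∩ {ω | ω (n + 1) ∉ some '' trap}) := measure_iUnion_le _
    _ ≤ ∑' n, (1 - δ) * μ (leaveAt good bad n) :=
        ENNReal.tsum_le_tsum fun n => playMeasure_leaveAt_inter_le good hbad σ c n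
    _ = (1 - δ) * μ (⋃ n, leaveAt good bad n) := by
        rw [ENNReal.tsum_mul_left, measure_iUnion (pairwise_disjoint_leaveAt hgb)
          (measurableSet_leaveAt good bad)]
    _ ≤ 1 - δ := mul_le_of_le_one_right' prob_le_one

end Measure

open Classical in
/-- The strategy that moves along the infinite path `w` for as long as the play has followed `w`,
and to an arbitrary successor elsewhere. -/
noncomputable def followPath (w : ℕ → C) (hw : ∀ n, M.Step (w n) (w (n + 1))) : M.Strategy where
  choose h :=
    if h.getLast? = some (w (h.length - 1)) then w h.length
    else if hd : ∃ b a, h.getLast? = some a ∧ M.Step a b then hd.choose else w 0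
  step_choose h a _ _ hd := by
    simp only [List.getLast?_append, List.getLast?_singleton, Option.some_or,
      List.length_append, List.length_singleton, Nat.add_sub_cancel]
    split_ifs with hlast hstep
    · obtain rfl : a = w h.length := by simpa using hlast
      exact hw _
    · obtain ⟨a', ha', hs⟩ := hstep.choose_spec
      obtain rfl : a = a' := by simpa using ha'
      exact hs
    · obtain ⟨b, hb⟩ := not_not.1 hd
      exact absurd ⟨b, a, rfl, hb⟩ hstep

theorem followPath_choose_ofFn (w : ℕ → C) (hw : ∀ n, M.Step (w n) (w (n + 1))) (n : ℕ) :
    (followPath w hw).choose (List.ofFn fun i : Fin (n + 1) => w i) = w (n + 1) := by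
  simp only [followPath]
  rw [if_pos]
  · simp
  · rw [List.ofFn_succ']
    simp

theorem history_eq_ofFn {w : ℕ → C} {ω : ℕ → Option C} {n : ℕ} (h : ∀ i ≤ n, ω i = some (w i)) :
    history ω n = List.ofFn fun i : Fin (n + 1) => w i := by
  induction n with
  | zero => simp [history_zero, h]
  | succ n ih =>
    rw [history_succ, ih fun i hi => h i (by lia), h _ le_rfl, List.ofFn_succ' (n := n + 1)]
    simp

theorem eq_of_mem_plays_followPath {w : ℕ → C} (hw : ∀ n, M.Step (w n) (w (n + 1)))
    (hdet : ∀ n, w n ∉ M.player1 → ∀ b, M.Step (w n) b → b = w (n + 1)) {ω : ℕ → Option C}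
    (hω : ω ∈ plays (followPath w hw) (w 0)) (n : ℕ) : ω n = some (w n) := by
  induction n using Nat.strong_induction_on with | _ n ih => ?_
  cases n with
  | zero => exact hω.1.1
  | succ n =>
    have hn := ih n n.lt_succ_self
    have hd : ¬ M.Deadlock (w n) := not_not.2 ⟨_, hw n⟩
    by_cases h1 : w n ∈ M.player1
    · rw [hω.2 n _ hn h1 hd, history_eq_ofFn fun i hi => ih i (Nat.lt_succ_of_le hi),
        followPath_choose_ofFn]
    · obtain ⟨b, hs, hb⟩ := hω.1.step hn hd
      rw [hb, hdet n h1 b hs]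

/-- A step from `c` to `c'` that is the only possible one unless Player 1 chooses it. -/
def SafeStep (M : MDP C) (c c' : C) : Prop :=
  M.Step c c' ∧ (c ∉ M.player1 → ∀ b, M.Step c b → b = c')

theorem surely_repeatedReach_of_reflTransGen {c b : C} {F : Set C}
    (h : Relation.ReflTransGen M.SafeStep c b) (hb : M.SafeStep b b) (hF : b ∈ F) :
    M.Surely c (repeatedReach F) := by
  obtain ⟨w, rfl, hw, N, hN⟩ := exists_path_of_reflTransGen h hb
  refine ⟨followPath w fun n => (hw n).1, fun ω hω m => ⟨max m N, le_max_left m N, b, hF, ?_⟩⟩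
  rw [eq_of_mem_plays_followPath _ (fun n => (hw n).2) hω, hN _ (le_max_right m N)]

end MDP

section RegularLanguages

variable {α : Type*} {L M : Language α}

/-- Every residual of `L` is the union of the members of `F` that it contains. -/
theorem isRegular_of_finite_cover {F : Set (Language α)} (hF : F.Finite)
    (h : ∀ x w, x ++ w ∈ L → ∃ A ∈ F, w ∈ A ∧ ∀ v ∈ A, x ++ v ∈ L) : L.IsRegular := by
  refine .of_finite_range_leftQuotient ((hF.powerset.image sSup).subset ?_)
  rintro _ ⟨x, rfl⟩
  refine ⟨{A ∈ F | A ≤ L.leftQuotient x}, Set.sep_subset _ _, le_antisymm ?_ ?_⟩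
  · exact sSup_le fun A hA => hA.2
  · intro w hw
    obtain ⟨A, hA, hwA, hle⟩ := h x w hw
    exact le_sSup (a := A) (s := {A ∈ F | A ≤ L.leftQuotient x}) ⟨hA, hle⟩ hwA

theorem isRegular_mul (hL : L.IsRegular) (hM : M.IsRegular) : (L * M).IsRegular := by
  refine isRegular_of_finite_cover ((hL.finite_range_leftQuotient.image (· * M)).union
    hM.finite_range_leftQuotient) fun x w hxw => ?_
  obtain ⟨a, ha, b, hb, hab⟩ := Language.mem_mul.1 hxw
  obtain ⟨c, rfl, rfl⟩ | ⟨c, rfl, rfl⟩ := List.append_eq_append_iff.1 hab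
  · refine ⟨M.leftQuotient c, Or.inr ⟨c, rfl⟩, hb, fun v hv => ?_⟩
    rw [List.append_assoc]
    exact Language.append_mem_mul ha hv
  · refine ⟨_, Or.inl ⟨_, ⟨x, rfl⟩, rfl⟩, Language.append_mem_mul ha hb, fun v hv => ?_⟩
    obtain ⟨c', hc', b', hb', rfl⟩ := Language.mem_mul.1 hv
    rw [← List.append_assoc]
    exact Language.append_mem_mul hc' hb'

theorem append_mem_kstar {a b : List α} (ha : a ∈ L) (hb : b ∈ KStar.kstar L) :
    a ++ b ∈ KStar.kstar L := by
  rw [← Language.one_add_self_mul_kstar_eq_kstar]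
  exact Or.inr (Language.append_mem_mul ha hb)

theorem isRegular_kstar (hL : L.IsRegular) : (KStar.kstar L).IsRegular := by
  refine isRegular_of_finite_cover
    ((hL.finite_range_leftQuotient.image (· * KStar.kstar L)).insert (KStar.kstar L))
    fun x w hxw => ?_
  obtain ⟨l, hl, hlL⟩ := Language.mem_kstar.1 hxw
  induction l generalizing x with
  | nil =>
    obtain ⟨rfl, rfl⟩ := List.append_eq_nil_iff.1 hl
    exact ⟨_, Or.inl rfl, hxw, fun v hv => hv⟩
  | cons y l ih =>
    have hlL' : ∀ z ∈ l, z ∈ L := fun z hz => hlL z (List.mem_cons_of_mem y hz)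
    have hy : y ∈ L := hlL y List.mem_cons_self
    have hl' : l.flatten ∈ KStar.kstar L := Language.join_mem_kstar hlL'
    obtain ⟨c, rfl, rfl⟩ | ⟨c, rfl, hc⟩ := List.append_eq_append_iff.1 hl
    · refine ⟨_, Or.inr ⟨_, ⟨x, rfl⟩, rfl⟩, Language.append_mem_mul hy hl', fun v hv => ?_⟩
      obtain ⟨c', hc', b, hb, rfl⟩ := Language.mem_mul.1 hv
      rw [← List.append_assoc]
      exact append_mem_kstar hc' hb
    · obtain ⟨A, hA, hwA, hle⟩ := ih c (hc ▸ hl') hc.symm hlL'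
      refine ⟨A, hA, hwA, fun v hv => ?_⟩
      rw [List.append_assoc]
      exact append_mem_kstar hy (hle v hv)

theorem isRegular_of_finite (hL : Set.Finite {w | w ∈ L}) : L.IsRegular := by
  refine isRegular_of_finite_cover (F := (fun w => ({w} : Set (List α))) ''
    ⋃ l ∈ {w | w ∈ L}, {w | w ∈ l.tails})
    ((hL.biUnion fun l _ => List.finite_toSet l.tails).image _)
    fun x w hxw => ⟨({w} : Set (List α)), ⟨w, ?_, rfl⟩, rfl, ?_⟩
  · exact Set.mem_biUnion (x := x ++ w) hxw ((List.mem_tails _ _).2 (List.suffix_append x w))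
  · rintro _ rfl
    exact hxw

end RegularLanguages

section CounterPrograms

variable {ι : Type*} [DecidableEq ι]

/-- The instructions of a counter machine with counters `ι`. -/
inductive CounterAction (ι : Type*)
  | inc (i : ι)
  | dec (i : ι)
  | test (i : ι)

/-- The effect of an instruction: `dec i` is blocked when counter `i` is zero, and `test i` is
blocked when it is not. -/
def CounterAction.Rel : CounterAction ι → (ι → ℕ) → (ι → ℕ) → Prop
  | inc i, u, v => v = u + Pi.single i 1
  | dec i, u, v => u = v + Pi.single i 1
  | test i, u, v => u i = 0 ∧ v = u

/-- The input-output relations of nondeterministic counter programs, which are built from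
instructions by choice, sequential composition and iteration. -/
inductive CounterDefinable : ((ι → ℕ) → (ι → ℕ) → Prop) → Prop
  | action (x : CounterAction ι) : CounterDefinable x.Rel
  | bot : CounterDefinable ⊥
  | eq : CounterDefinable Eq
  | sup {R R'} (h : CounterDefinable R) (h' : CounterDefinable R') : CounterDefinable (R ⊔ R')
  | comp {R R'} (h : CounterDefinable R) (h' : CounterDefinable R') :
      CounterDefinable (Relation.Comp R R')
  | star {R} (h : CounterDefinable R) : CounterDefinable (Relation.ReflTransGen R)

theorem update_add_single (u : ι → ℕ) (i : ι) (x y : ℕ) :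
    Function.update u i (x + y) = Function.update u i x + Pi.single i y := by
  ext j
  obtain rfl | hj := eq_or_ne j i <;> simp [*]

namespace CounterDefinable

theorem add (i : ι) (r : ℕ) : CounterDefinable fun u v : ι → ℕ => v = u + Pi.single i r := by
  induction r with
  | zero => simpa [eq_comm] using CounterDefinable.eq (ι := ι)
  | succ r ih =>
    convert ih.comp (.action (.inc i)) using 3 with u v
    simp [Relation.Comp, CounterAction.Rel, Pi.single_add, add_assoc]

theorem sub (i : ι) (r : ℕ) : CounterDefinable fun u v : ι → ℕ => u = v + Pi.single i r := by
  induction r with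
  | zero => simpa using CounterDefinable.eq (ι := ι)
  | succ r ih =>
    convert (CounterDefinable.action (.dec i)).comp ih using 3 with u v
    simp [Relation.Comp, CounterAction.Rel, Pi.single_add, add_assoc]

theorem reflTransGen_exchange_iff {i j : ι} (hij : i ≠ j) {s t : ℕ} {u v : ι → ℕ} :
    Relation.ReflTransGen
        (fun u v : ι → ℕ => ∃ m : ι → ℕ, u = m + Pi.single i s ∧ v = m + Pi.single j t) u v ↔
      ∃ (k : ℕ) (m : ι → ℕ), u = m + Pi.single i (s * k) ∧ v = m + Pi.single j (t * k) := by
  constructor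
  · intro h
    induction h with
    | refl => exact ⟨0, u, by simp, by simp⟩
    | tail _ hstep ih =>
      obtain ⟨k, m, rfl, rfl⟩ := ih
      obtain ⟨m', h, rfl⟩ := hstep
      have hmi : m i = m' i + s := by simpa [hij] using congrFun h i
      have hle : Pi.single i s ≤ m := update_le_iff.2 ⟨by lia, fun _ _ => Nat.zero_le _⟩
      obtain ⟨m, rfl⟩ := exists_add_of_le hle
      obtain rfl : m + Pi.single j (t * k) = m' := by
        rw [add_assoc, add_comm] at h
        exact add_right_cancel h
      exact ⟨k + 1, m, by simp only [mul_add, mul_one, Pi.single_add]; abel,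
        by simp only [mul_add, mul_one, Pi.single_add]; abel⟩
  · rintro ⟨k, m, rfl, rfl⟩
    induction k generalizing m with
    | zero => simpa using Relation.ReflTransGen.refl
    | succ k ih =>
      refine .head ⟨m + Pi.single i (s * k), ?_, rfl⟩ ?_
      · rw [mul_add, mul_one, Pi.single_add, add_assoc]
      · convert ih (m + Pi.single j t) using 1
        · abel
        · simp only [mul_add, mul_one, Pi.single_add]
          abel

theorem transfer {i j : ι} (hij : i ≠ j) (s t : ℕ) :
    CounterDefinable fun u v : ι → ℕ => ∃ (k : ℕ) (m : ι → ℕ), m i = 0 ∧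
      u = m + Pi.single i (s * k) ∧ v = m + Pi.single j (t * k) := by
  convert ((sub i s).comp (add j t)).star.comp (.action (.test i)) using 3 with u v
  have hstep : Relation.Comp (fun u v : ι → ℕ => u = v + Pi.single i s)
      (fun u v => v = u + Pi.single j t) =
      fun u v => ∃ m : ι → ℕ, u = m + Pi.single i s ∧ v = m + Pi.single j t := rfl
  simp only [Relation.Comp, CounterAction.Rel, hstep, reflTransGen_exchange_iff hij]
  constructor
  · rintro ⟨k, m, hm, rfl, rfl⟩
    exact ⟨_, ⟨k, m, rfl, rfl⟩, by simp [hm, hij], rfl⟩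
  · rintro ⟨_, ⟨k, m, rfl, rfl⟩, hm, rfl⟩
    exact ⟨k, m, by simpa [hij] using hm, rfl, rfl⟩

/-- The contents of counter `i` are moved to the scratch counter `j` and back. -/
theorem scale {i j : ι} (hij : i ≠ j) (s t : ℕ) :
    CounterDefinable fun u v : ι → ℕ => u j = 0 ∧
      ∃ k, u i = s * k ∧ v = Function.update u i (t * k) := by
  convert ((CounterDefinable.action (.test j)).comp (transfer hij s 1)).comp
    (transfer hij.symm 1 t) using 3 with u v
  simp only [Relation.Comp, CounterAction.Rel]
  constructor
  · rintro ⟨hj, k, hi, rfl⟩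
    have hupd (x : ℕ) : Function.update u i x = Function.update u i 0 + Pi.single i x := by
      rw [← update_add_single, zero_add]
    refine ⟨Function.update u i 0 + Pi.single j k, ⟨_, ⟨hj, rfl⟩, k, Function.update u i 0,
      by simp, ?_, by simp⟩, k, Function.update u i 0, by simp [hij.symm, hj], by simp, hupd _⟩
    rw [← hi, ← hupd, Function.update_eq_self]
  · rintro ⟨_, ⟨_, ⟨hj, rfl⟩, k, m, hm, rfl, rfl⟩, k', m', hm', h, rfl⟩
    have hmj : m j = 0 := by simpa [hij.symm] using hj
    obtain rfl : k = k' := by simpa [hmj, hm'] using congrFun h j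
    obtain rfl : m = m' := add_right_cancel h
    refine ⟨by simpa [hij.symm], k, by simp [hm], ?_⟩
    ext l
    by_cases hl : l = i
    · subst hl
      simp [hm]
    · simp [hl]

/-- `(s, r)` tests the divisor and the remainder, `(s', r')` rebuilds the counter. -/
theorem affine {i j : ι} (hij : i ≠ j) (s r s' r' : ℕ) :
    CounterDefinable fun u v : ι → ℕ => u j = 0 ∧
      ∃ k, u i = s * k + r ∧ v = Function.update u i (s' * k + r') := by
  convert ((sub i r).comp (scale hij s s')).comp (add i r') using 3 with u v
  simp only [Relation.Comp]
  constructor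
  · rintro ⟨hj, k, hi, rfl⟩
    refine ⟨_, ⟨Function.update u i (s * k), ?_, by simp [hij.symm, hj], k, by simp, rfl⟩, ?_⟩
    · rw [← update_add_single, ← hi, Function.update_eq_self]
    · rw [Function.update_idem, update_add_single]
  · rintro ⟨_, ⟨m, rfl, hj, k, hi, rfl⟩, rfl⟩
    refine ⟨by simp [hij.symm, hj], k, by simp [hi], ?_⟩
    ext l
    by_cases hl : l = i
    · subst hl
      simp
    · simp [hl]

theorem iSup {κ : Type*} [Finite κ] {R : κ → (ι → ℕ) → (ι → ℕ) → Prop}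
    (h : ∀ a, CounterDefinable (R a)) : CounterDefinable (⨆ a, R a) :=
  SupClosed.iSup_mem (s := {R | CounterDefinable R}) (fun _ h _ h' => h.sup h') .bot h

end CounterDefinable

end CounterPrograms

section Words

variable {ι : Type*} [DecidableEq ι]

namespace CounterAction

/-- The input-output relation of a sequence of instructions. -/
def Run : List (CounterAction ι) → (ι → ℕ) → (ι → ℕ) → Prop
  | [] => Eq
  | x :: w => Relation.Comp x.Rel (Run w)

theorem run_append (w w' : List (CounterAction ι)) :
    Run (w ++ w') = Relation.Comp (Run w) (Run w') := by
  induction w with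
  | nil => exact (Relation.eq_comp).symm
  | cons x w ih => rw [List.cons_append, Run, ih, Run, Relation.comp_assoc]

/-- The input-output relation of a set of sequences of instructions. -/
def RunOf (L : Language (CounterAction ι)) (u v : ι → ℕ) : Prop := ∃ w ∈ L, Run w u v

theorem runOf_add (L L' : Language (CounterAction ι)) : RunOf (L + L') = RunOf L ⊔ RunOf L' := by
  ext u v
  simp only [RunOf, Language.mem_add, or_and_right, exists_or]
  rfl

theorem runOf_mul (L L' : Language (CounterAction ι)) :
    RunOf (L * L') = Relation.Comp (RunOf L) (RunOf L') := by
  ext u v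
  constructor
  · rintro ⟨_, ⟨w, hw, w', hw', rfl⟩, h⟩
    obtain ⟨m, h, h'⟩ := (run_append w w' ▸ h : Relation.Comp (Run w) (Run w') u v)
    exact ⟨m, ⟨w, hw, h⟩, w', hw', h'⟩
  · rintro ⟨m, ⟨w, hw, h⟩, w', hw', h'⟩
    exact ⟨w ++ w', Language.append_mem_mul hw hw', (run_append w w').symm ▸ ⟨m, h, h'⟩⟩

theorem runOf_kstar (L : Language (CounterAction ι)) :
    RunOf (KStar.kstar L) = Relation.ReflTransGen (RunOf L) := by
  ext u v
  constructor
  · rintro ⟨w, hw, h⟩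
    obtain ⟨l, rfl, hl⟩ := Language.mem_kstar.1 hw
    clear hw
    induction l generalizing u with
    | nil => exact h ▸ .refl
    | cons x l ih =>
      have hlL : ∀ y ∈ l, y ∈ L := fun y hy => hl y (List.mem_cons_of_mem x hy)
      rw [List.flatten_cons, run_append] at h
      obtain ⟨m, hx, h⟩ := h
      exact .head ⟨x, hl x List.mem_cons_self, hx⟩
        (ih m hlL h)
  · intro h
    induction h using Relation.ReflTransGen.head_induction_on with
    | refl => exact ⟨[], Language.nil_mem_kstar L, rfl⟩
    | head h _ ih =>
      obtain ⟨w, hw, h⟩ := h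
      obtain ⟨w', hw', h'⟩ := ih
      exact ⟨w ++ w', append_mem_kstar hw hw', (run_append w w').symm ▸ ⟨_, h, h'⟩⟩

end CounterAction

theorem CounterDefinable.exists_isRegular {R : (ι → ℕ) → (ι → ℕ) → Prop}
    (h : CounterDefinable R) :
    ∃ L : Language (CounterAction ι), L.IsRegular ∧ CounterAction.RunOf L = R := by
  induction h with
  | action x =>
    refine ⟨({[x]} : Set _), isRegular_of_finite (Set.finite_singleton [x]), ?_⟩
    have hx : CounterAction.Run [x] = x.Rel := Relation.comp_eq
    ext u v
    exact ⟨fun ⟨w, hw, h⟩ => hx ▸ (Set.mem_singleton_iff.1 hw) ▸ h,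
      fun h => ⟨[x], rfl, hx ▸ h⟩⟩
  | bot => exact ⟨0, isRegular_of_finite Set.finite_empty, by
      ext; simp [CounterAction.RunOf]⟩
  | eq => exact ⟨1, isRegular_of_finite (Set.finite_singleton []), by
      ext; simp [CounterAction.RunOf, CounterAction.Run]⟩
  | sup _ _ ih ih' =>
    obtain ⟨⟨L, hL, rfl⟩, L', hL', rfl⟩ := And.intro ih ih'
    exact ⟨L + L', hL.add hL', CounterAction.runOf_add L L'⟩
  | comp _ _ ih ih' =>
    obtain ⟨⟨L, hL, rfl⟩, L', hL', rfl⟩ := And.intro ih ih'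
    exact ⟨L * L', isRegular_mul hL hL', CounterAction.runOf_mul L L'⟩
  | star _ ih =>
    obtain ⟨L, hL, rfl⟩ := ih
    exact ⟨KStar.kstar L, isRegular_kstar hL, CounterAction.runOf_kstar L⟩

end Words

/-- The relation `ρ` is computed by a counter program when its arguments and its values are
represented by the counter values `enc` and `enc'`. -/
def CounterComputable {ι : Type*} [DecidableEq ι] {α β : Type*} (enc : α → ι → ℕ)
    (enc' : β → ι → ℕ) (ρ : α → β → Prop) : Prop :=
  ∃ R, CounterDefinable R ∧ ∀ a w, R (enc a) w ↔ ∃ b, ρ a b ∧ w = enc' b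

namespace CounterComputable

variable {ι α β γ : Type*} [DecidableEq ι] {enc : α → ι → ℕ} {enc' : β → ι → ℕ}
  {enc'' : γ → ι → ℕ}

theorem comp {ρ : α → β → Prop} {ρ' : β → γ → Prop} (h : CounterComputable enc enc' ρ)
    (h' : CounterComputable enc' enc'' ρ') :
    CounterComputable enc enc'' (Relation.Comp ρ ρ') := by
  obtain ⟨R, hR, h⟩ := h
  obtain ⟨R', hR', h'⟩ := h'
  refine ⟨_, hR.comp hR', fun a w => ?_⟩
  simp only [Relation.Comp, h]
  constructor
  · rintro ⟨_, ⟨b, hb, rfl⟩, hw⟩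
    obtain ⟨c, hc, rfl⟩ := (h' b w).1 hw
    exact ⟨c, ⟨b, hb, hc⟩, rfl⟩
  · rintro ⟨c, ⟨b, hb, hc⟩, rfl⟩
    exact ⟨_, ⟨b, hb, rfl⟩, (h' b _).2 ⟨c, hc, rfl⟩⟩

theorem iSup {κ : Type*} [Finite κ] {ρ : κ → α → β → Prop}
    (h : ∀ i, CounterComputable enc enc' (ρ i)) : CounterComputable enc enc' (⨆ i, ρ i) := by
  choose R hR h using h
  refine ⟨⨆ i, R i, .iSup hR, fun a w => ?_⟩
  simp only [iSup_apply, iSup_Prop_eq, h]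
  grind

theorem star {ρ : α → α → Prop} (h : CounterComputable enc enc ρ) :
    CounterComputable enc enc (Relation.ReflTransGen ρ) := by
  obtain ⟨R, hR, h⟩ := h
  refine ⟨_, hR.star, fun a w => ⟨fun hw => ?_, ?_⟩⟩
  · induction hw with
    | refl => exact ⟨a, .refl, rfl⟩
    | tail _ hstep ih =>
      obtain ⟨b, hb, rfl⟩ := ih
      obtain ⟨c, hc, rfl⟩ := (h b _).1 hstep
      exact ⟨c, hb.tail hc, rfl⟩
  · rintro ⟨b, hb, rfl⟩
    exact hb.lift enc fun a b hab => (h a _).2 ⟨b, hab, rfl⟩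

end CounterComputable

section Godel

variable {ι : Type*} [Fintype ι]

/-- The Gödel number of a tuple of counter values. -/
def godel (p : ι → ℕ) (x : ι → ℕ) : ℕ := ∏ i, p i ^ x i

variable {p : ι → ℕ}

theorem godel_add_single [DecidableEq ι] (x : ι → ℕ) (i : ι) (m : ℕ) :
    godel p (x + Pi.single i m) = p i ^ m * godel p x := by
  simp only [godel, Pi.add_apply, pow_add, Finset.prod_mul_distrib]
  rw [mul_comm, Fintype.prod_eq_single i fun j hj => by simp [hj]]
  simp

theorem dvd_godel_iff (hp : ∀ i, (p i).Prime) (hinj : Function.Injective p) (i : ι) (x : ι → ℕ) :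
    p i ∣ godel p x ↔ x i ≠ 0 := by
  rw [godel, (hp i).prime.dvd_finsetProd_iff]
  constructor
  · rintro ⟨j, -, hj⟩
    obtain rfl := hinj ((Nat.prime_dvd_prime_iff_eq (hp i) (hp j)).1 ((hp i).dvd_of_dvd_pow hj))
    rintro h
    simp [h, (hp i).ne_one] at hj
  · exact fun h => ⟨i, Finset.mem_univ i, dvd_pow_self _ h⟩

/-- The two counter values that represent the tuple `x`: its Gödel number and a scratch counter. -/
def godelPair (p : ι → ℕ) (x : ι → ℕ) : Fin 2 → ℕ := ![godel p x, 0]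

theorem counterDefinable_godelPair (s r s' r' : ℕ) : ∃ R, CounterDefinable R ∧ ∀ (x : ι → ℕ) w,
    R (godelPair p x) w ↔ ∃ k, godel p x = s * k + r ∧ w = ![s' * k + r', 0] := by
  refine ⟨_, .affine (zero_ne_one (α := Fin 2)) s r s' r', fun x w => ?_⟩
  have hupd (y : ℕ) : Function.update (godelPair p x) 0 y = ![y, 0] := by
    ext i
    fin_cases i <;> rfl
  simp only [hupd]
  simp [godelPair]

variable [DecidableEq ι]

theorem counterComputable_godelPair_inc (i : ι) : CounterComputable (godelPair p) (godelPair p)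
    (CounterAction.inc i).Rel := by
  obtain ⟨R, hR, h⟩ := counterDefinable_godelPair (p := p) 1 0 (p i) 0
  refine ⟨R, hR, fun x w => ?_⟩
  simp only [h, CounterAction.Rel]
  simp [godelPair, godel_add_single]

theorem counterComputable_godelPair_dec (hp : ∀ i, (p i).Prime) (hinj : Function.Injective p)
    (i : ι) : CounterComputable (godelPair p) (godelPair p) (CounterAction.dec i).Rel := by
  obtain ⟨R, hR, h⟩ := counterDefinable_godelPair (p := p) (p i) 0 1 0
  refine ⟨R, hR, fun x w => (h x w).trans ⟨?_, ?_⟩⟩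
  · rintro ⟨k, hk, rfl⟩
    have hx : x i ≠ 0 := (dvd_godel_iff hp hinj i x).1 ⟨k, hk⟩
    have hle : Pi.single i 1 ≤ x :=
      update_le_iff.2 ⟨Nat.one_le_iff_ne_zero.2 hx, fun _ _ => Nat.zero_le _⟩
    obtain ⟨y, rfl⟩ := exists_add_of_le hle
    rw [add_comm, godel_add_single, pow_one] at hk
    obtain rfl := Nat.eq_of_mul_eq_mul_left (hp i).pos hk
    exact ⟨y, add_comm _ _, by simp [godelPair]⟩
  · rintro ⟨y, rfl, rfl⟩
    exact ⟨godel p y, by rw [godel_add_single, pow_one, add_zero], by simp [godelPair]⟩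

/-- Counter `i` is zero if and only if the Gödel number has a nonzero remainder modulo `p i`. -/
theorem counterComputable_godelPair_test (hp : ∀ i, (p i).Prime) (hinj : Function.Injective p)
    (i : ι) : CounterComputable (godelPair p) (godelPair p) (CounterAction.test i).Rel := by
  choose R hR h using fun r : Finset.Ioo 0 (p i) =>
    counterDefinable_godelPair (p := p) (p i) r.1 (p i) r.1
  refine ⟨⨆ r, R r, .iSup hR, fun x w => ?_⟩
  simp only [iSup_apply, iSup_Prop_eq, h, CounterAction.Rel]
  have hdvd := (dvd_godel_iff hp hinj i x).not_left
  constructor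
  · rintro ⟨⟨r, hr⟩, k, hk, rfl⟩
    rw [Finset.mem_Ioo] at hr
    refine ⟨x, ⟨?_, rfl⟩, by rw [← hk, godelPair]⟩
    rw [← hdvd, hk, Nat.dvd_add_right (dvd_mul_right _ _)]
    exact Nat.not_dvd_of_pos_of_lt hr.1 hr.2
  · rintro ⟨y, ⟨hx, rfl⟩, rfl⟩
    refine ⟨⟨godel p y % p i, Finset.mem_Ioo.2 ⟨?_, Nat.mod_lt _ (hp i).pos⟩⟩, godel p y / p i,
      (Nat.div_add_mod _ _).symm, by rw [Nat.div_add_mod, godelPair]⟩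
    exact Nat.pos_of_ne_zero fun h => hdvd.2 hx (Nat.dvd_of_mod_eq_zero h)

theorem CounterDefinable.counterComputable_godelPair (hp : ∀ i, (p i).Prime)
    (hinj : Function.Injective p) {R : (ι → ℕ) → (ι → ℕ) → Prop} (h : CounterDefinable R) :
    CounterComputable (godelPair p) (godelPair p) R := by
  induction h with
  | action x =>
    cases x with
    | inc i => exact counterComputable_godelPair_inc i
    | dec i => exact counterComputable_godelPair_dec hp hinj i
    | test i => exact counterComputable_godelPair_test hp hinj i
  | bot => exact ⟨⊥, .bot, by simp⟩
  | eq => exact ⟨Eq, .eq, by simp [eq_comm]⟩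
  | @sup R R' _ _ ih ih' =>
    rw [sup_eq_iSup]
    exact .iSup (Bool.rec ih' ih)
  | comp _ _ ih ih' => exact ih.comp ih'
  | star _ ih => exact ih.star

end Godel

section StackMachines

open Turing

/-- The registers that hold the configuration of a machine with stacks `K`: one for every stack,
one for the control state, and one for scratch work. -/
inductive StackRegister (K : Type*)
  | stack (k : K)
  | control
  | scratch
  deriving DecidableEq, Fintype

variable {K Γ Λ σ : Type*} [DecidableEq K] [Fintype Γ] [Fintype σ]

/-- The contents of a stack as a number in base `card Γ + 1` with nonzero digits, the top of the
stack being the least significant digit. -/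
noncomputable def stackCode (L : List Γ) : ℕ :=
  Nat.ofDigits (Fintype.card Γ + 1) (L.map fun a => (Fintype.equivFin Γ a : ℕ) + 1)

theorem stackCode_cons (a : Γ) (L : List Γ) :
    stackCode (a :: L) = (Fintype.card Γ + 1) * stackCode L + (Fintype.equivFin Γ a + 1) := by
  rw [stackCode, List.map_cons, Nat.ofDigits_cons, add_comm, stackCode]

theorem stackCode_eq_zero_iff {L : List Γ} : stackCode L = 0 ↔ L = [] := by
  cases L with
  | nil => simp [stackCode]
  | cons a L => simp [stackCode_cons]

theorem stackCode_eq_iff {L : List Γ} {a : Γ} {m : ℕ} :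
    stackCode L = (Fintype.card Γ + 1) * m + (Fintype.equivFin Γ a + 1) ↔
      ∃ L', L = a :: L' ∧ m = stackCode L' := by
  cases L with
  | nil => simp [stackCode]
  | cons b L =>
    have hlt (c : Γ) : (Fintype.equivFin Γ c : ℕ) + 1 < Fintype.card Γ + 1 :=
      Nat.succ_lt_succ (Fin.is_lt _)
    rw [stackCode_cons]
    constructor
    · intro h
      have hmod := congrArg (· % (Fintype.card Γ + 1)) h
      simp only [Nat.mul_add_mod, Nat.mod_eq_of_lt (hlt _), add_left_inj, Fin.val_inj,
        EmbeddingLike.apply_eq_iff_eq] at hmod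
      subst hmod
      exact ⟨L, rfl, (Nat.eq_of_mul_eq_mul_left (Nat.succ_pos _) (add_right_cancel h)).symm⟩
    · rintro ⟨L', h, rfl⟩
      rw [List.cons.injEq] at h
      rw [h.1, h.2]

/-- The register values for the stacks `T` and the control value `n`. -/
noncomputable def registers (T : K → List Γ) (n : ℕ) : StackRegister K → ℕ
  | .stack k => stackCode (T k)
  | .control => n
  | .scratch => 0

omit [Fintype σ] in
theorem registers_update_stack (T : K → List Γ) (n : ℕ) (k : K) (L : List Γ) :
    Function.update (registers T n) (.stack k) (stackCode L) =
      registers (Function.update T k L) n := by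
  ext i
  cases i with
  | stack l => obtain rfl | hl := eq_or_ne l k <;> simp [registers, *]
  | _ => simp [registers]

theorem registers_update_control (T : K → List Γ) (n n' : ℕ) :
    Function.update (registers T n) .control n' = registers T n' := by
  ext i
  cases i <;> simp [registers]

section StackOperations

variable (n : ℕ) (k : K)

theorem counterComputable_push (a : Γ) : CounterComputable (registers · n) (registers · n)
    fun T T' : K → List Γ => T' = Function.update T k (a :: T k) := by
  refine ⟨_, .affine (i := .stack k) (j := .scratch) (by simp) 1 0 (Fintype.card Γ + 1)
    (Fintype.equivFin Γ a + 1), fun T w => ?_⟩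
  simp [registers, ← stackCode_cons, registers_update_stack]

theorem counterComputable_top (a : Γ) (f : List Γ → List Γ) {s r : ℕ}
    (hf : ∀ L, stackCode (f L) = s * stackCode L + r) :
    CounterComputable (registers · n) (registers · n)
      fun T T' : K → List Γ => ∃ L, T k = a :: L ∧ T' = Function.update T k (f L) := by
  refine ⟨_, .affine (i := .stack k) (j := .scratch) (by simp) (Fintype.card Γ + 1)
    (Fintype.equivFin Γ a + 1) s r, fun T w => ?_⟩
  simp only [registers, stackCode_eq_iff]
  constructor
  · rintro ⟨-, _, ⟨L, hL, rfl⟩, rfl⟩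
    exact ⟨_, ⟨L, hL, rfl⟩, by rw [← hf, registers_update_stack]⟩
  · rintro ⟨_, ⟨L, hL, rfl⟩, rfl⟩
    exact ⟨trivial, _, ⟨L, hL, rfl⟩, by rw [← hf, registers_update_stack]⟩

theorem counterComputable_isEmpty : CounterComputable (registers · n) (registers · n)
    fun T T' : K → List Γ => T k = [] ∧ T' = T := by
  refine ⟨_, .affine (i := .stack k) (j := .scratch) (by simp) 0 0 0 0, fun T w => ?_⟩
  have hnil : stackCode ([] : List Γ) = 0 := stackCode_eq_zero_iff.2 rfl
  have hupd := registers_update_stack T n k []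
  rw [hnil] at hupd
  simp only [zero_mul, zero_add, registers, hupd, stackCode_eq_zero_iff, true_and]
  constructor
  · rintro ⟨-, hT, rfl⟩
    exact ⟨T, ⟨hT, rfl⟩, by rw [← hT, Function.update_eq_self]⟩
  · rintro ⟨_, ⟨hT, rfl⟩, rfl⟩
    exact ⟨0, hT, by rw [← hT, Function.update_eq_self]⟩

theorem counterComputable_peek (o : Option Γ) : CounterComputable (registers · n) (registers · n)
    fun T T' : K → List Γ => (T k).head? = o ∧ T' = T := by
  cases o with
  | none => simpa only [List.head?_eq_none_iff] using counterComputable_isEmpty n k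
  | some a =>
    convert counterComputable_top n k a (a :: ·) (stackCode_cons a) using 3 with T T'
    rw [List.head?_eq_some_iff, ← exists_and_right]
    refine exists_congr fun L => and_congr_right fun hL => ?_
    rw [← hL, Function.update_eq_self]

theorem counterComputable_pop (o : Option Γ) : CounterComputable (registers · n) (registers · n)
    fun T T' : K → List Γ => (T k).head? = o ∧ T' = Function.update T k (T k).tail := by
  cases o with
  | none =>
    convert counterComputable_isEmpty n k using 3 with T T'
    rw [List.head?_eq_none_iff]
    refine and_congr_right fun hT => ?_
    rw [hT, List.tail_nil, ← hT, Function.update_eq_self]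
  | some a =>
    convert counterComputable_top n k a id (s := 1) (r := 0) (by simp) using 3 with T T'
    rw [List.head?_eq_some_iff, ← exists_and_right]
    refine exists_congr fun L => and_congr_right fun hL => ?_
    rw [hL, List.tail_cons, id]

end StackOperations

/-- The number of the control state with label `l` and variables `v`. It is zero when the machine
has halted, and also, as a junk value, for the labels outside `S`. -/
noncomputable def controlCode [DecidableEq Λ] (S : Finset Λ) (v : σ) : Option Λ → ℕ
  | none => 0
  | some l => if h : l ∈ S then Fintype.equivFin (S × σ) (⟨l, h⟩, v) + 1 else 0

theorem controlCode_eq_iff [DecidableEq Λ] {S : Finset Λ} {l : Λ} (hl : l ∈ S) {v v' : σ}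
    {o : Option Λ} : controlCode S v' o = controlCode S v (some l) ↔ o = some l ∧ v' = v := by
  cases o with
  | none => simp [controlCode, hl]
  | some l' =>
    by_cases hl' : l' ∈ S
    · simp [controlCode, hl, hl', Fin.val_inj]
    · simp only [controlCode, hl, hl', ↓reduceDIte, Option.some.injEq]
      grind

theorem controlCode_eq_zero_iff [DecidableEq Λ] {S : Finset Λ} {v : σ} {o : Option Λ}
    (ho : o ∈ Finset.insertNone S) : controlCode S v o = 0 ↔ o = none := by
  cases o with
  | none => simp [controlCode]
  | some l => simp [controlCode, Finset.some_mem_insertNone.1 ho]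

section Simulation

variable [DecidableEq Λ]

/-- The register values for a configuration of a stack machine. -/
noncomputable def cfgRegisters (S : Finset Λ) (c : TM2.Cfg (fun _ : K => Γ) Λ σ) :
    StackRegister K → ℕ :=
  registers c.stk (controlCode S c.var c.l)

theorem counterComputable_enter (S : Finset Λ) (o : Option Λ) (v : σ) :
    CounterComputable (registers · 0) (cfgRegisters S)
      fun (T : K → List Γ) c => c = ⟨o, v, T⟩ := by
  refine ⟨_, .affine (i := .control) (j := .scratch) (by simp) 1 0 1 (controlCode S v o),
    fun T w => ?_⟩
  simp [registers, cfgRegisters, registers_update_control]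

theorem counterComputable_leave {S : Finset Λ} {l : Λ} (hl : l ∈ S) (v : σ) :
    CounterComputable (cfgRegisters S) (registers · 0)
      fun c (T : K → List Γ) => (c.l = some l ∧ c.var = v) ∧ T = c.stk := by
  refine ⟨_, .affine (i := .control) (j := .scratch) (by simp) 0 (controlCode S v (some l)) 0 0,
    fun T w => ?_⟩
  simp [registers, cfgRegisters, registers_update_control, controlCode_eq_iff hl]

theorem counterComputable_stepAux (S : Finset Λ) (q : TM2.Stmt (fun _ : K => Γ) Λ σ) (v : σ) :
    CounterComputable (registers · 0) (cfgRegisters S) fun T c => c = TM2.stepAux q v T := by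
  induction q generalizing v with
  | push k f q ih =>
    convert (counterComputable_push 0 k (f v)).comp (ih v) using 3 with T c
    simp [Relation.Comp]
  | peek k f q ih =>
    convert CounterComputable.iSup fun o => (counterComputable_peek 0 k o).comp (ih (f v o))
      using 3 with T c
    simp [Relation.Comp]
  | pop k f q ih =>
    convert CounterComputable.iSup fun o => (counterComputable_pop 0 k o).comp (ih (f v o))
      using 3 with T c
    simp [Relation.Comp]
  | load f _ ih => exact ih (f v)
  | branch f q q' ih ih' =>
    cases h : f v
    · simpa [h] using ih' v
    · simpa [h] using ih v
  | goto f => exact counterComputable_enter S (some (f v)) v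
  | halt => exact counterComputable_enter S none v

theorem counterComputable_step (S : Finset Λ) (M : Λ → TM2.Stmt (fun _ : K => Γ) Λ σ) :
    CounterComputable (cfgRegisters S) (cfgRegisters S)
      fun c c' => (∃ l ∈ S, c.l = some l) ∧ c' ∈ TM2.step M c := by
  convert CounterComputable.iSup fun i : S × σ =>
    (counterComputable_leave i.1.2 i.2).comp (counterComputable_stepAux S (M i.1) i.2)
    using 3 with c c'
  obtain ⟨_ | l, v, T⟩ := c <;> simp [Relation.Comp, eq_comm]

theorem counterDefinable_halts [Inhabited Λ] {S : Finset Λ}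
    {M : Λ → TM2.Stmt (fun _ : K => Γ) Λ σ} (hM : TM2.Supports M S) :
    ∃ R, CounterDefinable R ∧ ∀ c : TM2.Cfg (fun _ : K => Γ) Λ σ, c.l ∈ Finset.insertNone S →
      ((∃ w, R (cfgRegisters S c) w) ↔ (StateTransition.eval (TM2.step M) c).Dom) := by
  obtain ⟨R, hR, h⟩ := (counterComputable_step S M).star
  refine ⟨_, hR.comp (.action (.test .control)), fun c hc => ?_⟩
  have hl {c : TM2.Cfg (fun _ : K => Γ) Λ σ} :
      TM2.step M c = none ↔ c.l = none := by
    obtain ⟨_ | l, v, T⟩ := c <;> simp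
  have hreach {c'} (hc' : StateTransition.Reaches (TM2.step M) c c') :
      Relation.ReflTransGen
        (fun c c' => (∃ l ∈ S, c.l = some l) ∧ c' ∈ TM2.step M c) c c' ∧
        c'.l ∈ Finset.insertNone S := by
    induction hc' with
    | refl => exact ⟨.refl, hc⟩
    | @tail c' c'' _ hstep ih =>
      refine ⟨ih.1.tail ⟨?_, hstep⟩, TM2.step_supports M hM hstep ih.2⟩
      obtain ⟨_ | l, v, T⟩ := c'
      · cases hstep
      · exact ⟨l, Finset.some_mem_insertNone.1 ih.2, rfl⟩
  simp only [Part.dom_iff_mem, StateTransition.mem_eval, Relation.Comp, h]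
  constructor
  · rintro ⟨_, _, ⟨c', hc', rfl⟩, hzero, -⟩
    have hR := Relation.ReflTransGen.mono (fun _ _ h => h.2) _ _ hc'
    exact ⟨c', hR, hl.2 ((controlCode_eq_zero_iff (hreach hR).2).1 hzero)⟩
  · rintro ⟨c', hR, hnone⟩
    exact ⟨_, _, ⟨c', (hreach hR).1, rfl⟩,
      (controlCode_eq_zero_iff (hreach hR).2).2 (hl.1 hnone), rfl⟩

end Simulation

end StackMachines

section PartialRecursive

open Turing Turing.PartrecToTM2

theorem trNat_eq_cons {n : ℕ} (hn : n ≠ 0) :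
    trNat n = (if n % 2 = 0 then Γ'.bit0 else Γ'.bit1) :: trNat (n / 2) := by
  obtain ⟨m, rfl⟩ : ∃ m : Num, n = m := ⟨n, (Num.to_of_nat n).symm⟩
  cases m with
  | zero => exact absurd rfl hn
  | pos p =>
    have hpos (p : PosNum) : trNat (p : ℕ) = trPosNum p := by
      rw [trNat, PosNum.of_to_nat, trNum]
    cases p with
    | one => rfl
    | bit0 p =>
      rw [Num.cast_pos, hpos, PosNum.cast_bit0, if_pos (by lia),
        show (p + p : ℕ) / 2 = p by lia, hpos, trPosNum]
    | bit1 p =>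
      rw [Num.cast_pos, hpos, PosNum.cast_bit1, if_neg (by lia),
        show (p + p + 1 : ℕ) / 2 = p by lia, hpos, trPosNum]

/-- The number that is held by the main stack when the machine is started on the input `n`. -/
noncomputable def inputCode (n : ℕ) : ℕ := stackCode (trList [n])

theorem inputCode_of_ne_zero {n : ℕ} (hn : n ≠ 0) : inputCode n =
    5 * inputCode (n / 2) + if n % 2 = 0 then (Fintype.equivFin Γ' .bit0 : ℕ) + 1
      else (Fintype.equivFin Γ' .bit1 : ℕ) + 1 := by
  rw [inputCode, trList, trNat_eq_cons hn, List.cons_append, stackCode_cons]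
  split_ifs <;> rfl

theorem primrec_inputCode : Primrec inputCode := by
  let digit (n : ℕ) : ℕ :=
    if n % 2 = 0 then Fintype.equivFin Γ' .bit0 + 1 else Fintype.equivFin Γ' .bit1 + 1
  let next (l : List ℕ) : ℕ :=
    if l.length = 0 then inputCode 0 else 5 * (l[l.length / 2]?).getD 0 + digit l.length
  have hdigit : Primrec digit :=
    .ite (Primrec.eq.comp (Primrec.nat_mod.comp .id (.const 2)) (.const 0)) (.const _) (.const _)
  have hnext : Primrec next := by
    refine .ite (Primrec.eq.comp .list_length (.const 0)) (.const _) (Primrec.nat_add.comp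
      (Primrec.nat_mul.comp (.const 5) ?_) (hdigit.comp .list_length))
    exact Primrec.option_getD.comp (Primrec.list_getElem?.comp .id
      (Primrec.nat_div.comp .list_length (.const 2))) (.const 0)
  have hrec : Primrec₂ fun (_ : Unit) n => inputCode n := by
    refine Primrec.nat_strong_rec _ (g := fun _ l => some (next l))
      (Primrec.option_some.comp (hnext.comp .snd)) fun _ n => ?_
    obtain rfl | hn := eq_or_ne n 0
    · rfl
    · simp [next, hn, digit, inputCode_of_ne_zero hn, Nat.div_lt_self (Nat.pos_of_ne_zero hn)]
  exact hrec.comp (.const ()) .id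

instance : Fintype K' where
  elems := {.main, .rev, .aux, .stack}
  complete k := by cases k <;> simp

theorem exists_counterDefinable_dom_iff {f : ℕ →. ℕ} (hf : Partrec f) :
    ∃ R : (Fin 2 → ℕ) → (Fin 2 → ℕ) → Prop, CounterDefinable R ∧
      ∃ g : ℕ → ℕ, Computable g ∧ ∀ n, (∃ w, R ![g n, 0] w) ↔ (f n).Dom := by
  classical
  obtain ⟨c, hc⟩ := ToPartrec.Code.exists_code (Nat.Partrec'.part_iff₁.2 hf)
  obtain ⟨R, hR, h⟩ := @counterDefinable_halts _ _ _ _ _ _ _ _ ⟨trNormal c .halt⟩ _ _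
    (tr_supports c .halt)
  let p (i : StackRegister K') : ℕ := Nat.nth Nat.Prime (Fintype.equivFin _ i)
  have hp (i) : (p i).Prime := Nat.prime_nth_prime _
  have hinj : Function.Injective p := fun i j hij => (Fintype.equivFin _).injective
    (Fin.ext (Nat.nth_injective Nat.infinite_setOfPred_prime hij))
  obtain ⟨R', hR', h'⟩ := hR.counterComputable_godelPair hp hinj
  let x₀ := cfgRegisters (codeSupp c .halt) (init c [])
  have hinput (n : ℕ) : godelPair p (cfgRegisters (codeSupp c .halt) (init c [n])) =
      ![p (.stack .main) ^ inputCode n * godel p x₀, 0] := by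
    rw [← godel_add_single, godelPair]
    congr 2
    ext i
    obtain (_ | _ | _ | _) | _ | _ := i <;>
      simp [x₀, cfgRegisters, registers, init, inputCode, stackCode, trList]
  refine ⟨R', hR', fun n => p (.stack .main) ^ inputCode n * godel p x₀, ?_, fun n => ?_⟩
  · have hpow : Primrec₂ ((· ^ ·) : ℕ → ℕ → ℕ) := Primrec₂.unpaired'.1 Nat.Primrec.pow
    exact (Primrec.nat_mul.comp (hpow.comp (.const _) primrec_inputCode) (.const _)).to_comp
  · have hdom := h (init c [n]) (Finset.some_mem_insertNone.2 (tr_supports c .halt).1)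
    rw [tr_eval] at hdom
    have heval : (c.eval [n]).Dom ↔ (f n).Dom :=
      iff_of_eq (congrArg Part.Dom (hc (n ::ᵥ .nil)))
    rw [← heval, ← hinput]
    simp only [h']
    refine Iff.trans ?_ hdom
    exact ⟨fun ⟨_, y, hy, _⟩ => ⟨y, hy⟩, fun ⟨y, hy⟩ => ⟨_, y, hy, rfl⟩⟩

end PartialRecursive

section CounterAutomata

theorem VASSMDP.inv_card_le_stepProb {d : ℕ} {Q : Type} {S : VASSMDP d Q} (hτ : ∀ x, S.τ x = 1)
    {c c' : VASSConfig d Q} (h : S.Step c c') : (S.T.card : ENNReal)⁻¹ ≤ S.stepProb c c' := by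
  classical
  obtain ⟨r, hr, he, hf⟩ := h
  have hτ' : ∀ x, ((S.τ x : ℕ) : ENNReal) = 1 := fun x => by simp [hτ x]
  rw [VASSMDP.stepProb, ← one_div]
  refine ENNReal.div_le_div ?_ ?_
  · rw [← hτ' ⟨r, hr⟩]
    exact Finset.single_le_sum_of_canonicallyOrdered
      (f := fun x => ((S.τ x : ℕ) : ENNReal)) (Finset.mem_filter.2 ⟨S.mem_enabled.2 he, hf⟩)
  · simp only [hτ', Finset.sum_const, nsmul_eq_mul, mul_one]
    exact_mod_cast (Finset.card_le_univ _).trans_eq (Fintype.card_coe _)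

/-- Finite automata that read sequences of instructions for `d` counters. -/
abbrev CounterAutomaton (d : ℕ) (Q : Type) := DFA (CounterAction (Fin d)) Q

namespace CounterAutomaton

variable {d : ℕ} {Q : Type}

/-- The control states of the VASS-MDP of a counter automaton with states `Q`. Player 1 claims at
`check i q` that counter `i` is zero and wants to go on in state `q`; the probabilistic player
can refute a wrong claim by moving to `trap`. -/
inductive Control (d : ℕ) (Q : Type)
  | node (q : Q)
  | check (i : Fin d) (q : Q)
  | goal
  | trap
  deriving Fintype

open Control

/-- The transitions of the VASS-MDP of a counter automaton. -/
inductive IsTransition (M : CounterAutomaton d Q) : VASSTransition d (Control d Q) → Prop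
  | inc (q : Q) (i : Fin d) : IsTransition M (node q, Pi.single i 1, node (M.step q (.inc i)))
  | dec (q : Q) (i : Fin d) : IsTransition M (node q, -Pi.single i 1, node (M.step q (.dec i)))
  | test (q : Q) (i : Fin d) : IsTransition M (node q, 0, check i (M.step q (.test i)))
  | pass (i : Fin d) (q : Q) : IsTransition M (check i q, 0, node q)
  | refute (i : Fin d) (q : Q) : IsTransition M (check i q, -Pi.single i 1, trap)
  | accept {q : Q} (hq : q ∈ M.accept) : IsTransition M (node q, 0, goal)
  | stay : IsTransition M (goal, 0, goal)

theorem finite_isTransition [Finite Q] (M : CounterAutomaton d Q) :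
    {r | IsTransition M r}.Finite := by
  have := Fintype.ofFinite Q
  refine (Set.finite_univ.prod ((Set.finite_Icc (-1 : Fin d → ℤ) 1).prod Set.finite_univ)).subset ?_
  intro r hr
  have hsingle : ∀ i : Fin d, (Pi.single i 1 : Fin d → ℤ) ∈ Set.Icc 0 1 := fun i =>
    ⟨Pi.single_nonneg.2 zero_le_one, fun j => by rw [Pi.single_apply]; split_ifs <;> simp⟩
  have hz : (0 : Fin d → ℤ) ∈ Set.Icc (-1) 1 := by simp
  suffices r.2.1 ∈ Set.Icc (-1 : Fin d → ℤ) 1 from ⟨trivial, this, trivial⟩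
  cases hr with
  | inc q i => exact ⟨hz.1.trans (hsingle i).1, (hsingle i).2⟩
  | dec q i | refute i q => exact ⟨neg_le_neg (hsingle i).2, neg_le.1 (hz.1.trans (hsingle i).1)⟩
  | test | pass | accept | stay => exact hz

/-- The VASS-MDP of a counter automaton, with the control states numbered by `e`. -/
noncomputable def toVASSMDP [Finite Q] {k : ℕ} (M : CounterAutomaton d Q)
    (e : Control d Q ≃ Fin (k + 1)) : VASSMDP d (Fin (k + 1)) where
  Q1 := {x | ∀ i q, x ≠ e (check i q)}
  T := (M.finite_isTransition.image fun r => (e r.1, r.2.1, e r.2.2)).toFinset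
  τ _ := 1

variable [Finite Q] {k : ℕ} {M : CounterAutomaton d Q} {e : Control d Q ≃ Fin (k + 1)}

theorem toVASSMDP_step_iff {a : Control d Q} {u : Fin d → ℕ} {c : VASSConfig d (Fin (k + 1))} :
    (M.toVASSMDP e).toMDP.Step (e a, u) c ↔
      ∃ z b v, IsTransition M (a, z, b) ∧ (∀ i, (v i : ℤ) = u i + z i) ∧ c = (e b, v) := by
  constructor
  · rintro ⟨r, hr, ⟨h1, h2⟩, rfl⟩
    simp only [toVASSMDP, Set.Finite.mem_toFinset, Set.mem_image] at hr
    obtain ⟨⟨a', z, b⟩, hr, rfl⟩ := hr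
    obtain rfl := e.injective h1
    exact ⟨z, b, _, hr, fun i => Int.toNat_of_nonneg (h2 i), rfl⟩
  · rintro ⟨z, b, v, hr, hv, rfl⟩
    refine ⟨(e a, z, e b), ?_, ⟨rfl, fun i => ?_⟩, ?_⟩
    · simp only [toVASSMDP, Set.Finite.mem_toFinset, Set.mem_image]
      exact ⟨_, hr, rfl⟩
    · exact hv i ▸ Int.natCast_nonneg _
    · simp only [VASSMDP.fire, Prod.mk.injEq, true_and]
      funext i
      rw [← hv i, Int.toNat_natCast]

theorem mem_player1_iff {a : Control d Q} {u : Fin d → ℕ} :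
    (e a, u) ∈ (M.toVASSMDP e).toMDP.player1 ↔ ∀ i q, a ≠ check i q :=
  forall₂_congr fun _ _ => e.injective.ne_iff

theorem forall_intCast_eq_add_zero {u v : Fin d → ℕ} :
    (∀ j, (v j : ℤ) = u j + (0 : Fin d → ℤ) j) ↔ v = u := by
  simp [funext_iff]

theorem forall_intCast_eq_add_single {u v : Fin d → ℕ} {i : Fin d} :
    (∀ j, (v j : ℤ) = u j + (Pi.single i 1 : Fin d → ℤ) j) ↔ (CounterAction.inc i).Rel u v := by
  simp only [CounterAction.Rel, funext_iff, Pi.add_apply, Pi.single_apply]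
  exact forall_congr' fun j => by split_ifs <;> lia

theorem forall_intCast_eq_add_neg_single {u v : Fin d → ℕ} {i : Fin d} :
    (∀ j, (v j : ℤ) = u j + (-Pi.single i 1 : Fin d → ℤ) j) ↔
      (CounterAction.dec i).Rel u v := by
  simp only [CounterAction.Rel, funext_iff, Pi.add_apply, Pi.neg_apply, Pi.single_apply]
  exact forall_congr' fun j => by split_ifs <;> lia

theorem step_node_iff {q : Q} {u : Fin d → ℕ} {c : VASSConfig d (Fin (k + 1))} :
    (M.toVASSMDP e).toMDP.Step (e (node q), u) c ↔
      (∃ i v, (CounterAction.inc i).Rel u v ∧ c = (e (node (M.step q (.inc i))), v)) ∨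
      (∃ i v, (CounterAction.dec i).Rel u v ∧ c = (e (node (M.step q (.dec i))), v)) ∨
      (∃ i, c = (e (check i (M.step q (.test i))), u)) ∨ (q ∈ M.accept ∧ c = (e goal, u)) := by
  rw [toVASSMDP_step_iff]
  constructor
  · rintro ⟨z, b, v, hz, hv, rfl⟩
    cases hz with
    | inc _ i => exact .inl ⟨i, v, forall_intCast_eq_add_single.1 hv, rfl⟩
    | dec _ i => exact .inr (.inl ⟨i, v, forall_intCast_eq_add_neg_single.1 hv, rfl⟩)
    | test _ i => exact .inr (.inr (.inl ⟨i, by rw [forall_intCast_eq_add_zero.1 hv]⟩))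
    | accept hq => exact .inr (.inr (.inr ⟨hq, by rw [forall_intCast_eq_add_zero.1 hv]⟩))
  · rintro (⟨i, v, hv, rfl⟩ | ⟨i, v, hv, rfl⟩ | ⟨i, rfl⟩ | ⟨hq, rfl⟩)
    · exact ⟨_, _, v, .inc q i, forall_intCast_eq_add_single.2 hv, rfl⟩
    · exact ⟨_, _, v, .dec q i, forall_intCast_eq_add_neg_single.2 hv, rfl⟩
    · exact ⟨_, _, u, .test q i, forall_intCast_eq_add_zero.2 rfl, rfl⟩
    · exact ⟨_, _, u, .accept hq, forall_intCast_eq_add_zero.2 rfl, rfl⟩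

theorem step_check_iff {i : Fin d} {q : Q} {u : Fin d → ℕ} {c : VASSConfig d (Fin (k + 1))} :
    (M.toVASSMDP e).toMDP.Step (e (check i q), u) c ↔
      c = (e (node q), u) ∨ ∃ v, (CounterAction.dec i).Rel u v ∧ c = (e trap, v) := by
  rw [toVASSMDP_step_iff]
  constructor
  · rintro ⟨z, b, v, hz, hv, rfl⟩
    cases hz with
    | pass => exact .inl (by rw [forall_intCast_eq_add_zero.1 hv])
    | refute => exact .inr ⟨v, forall_intCast_eq_add_neg_single.1 hv, rfl⟩
  · rintro (rfl | ⟨v, hv, rfl⟩)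
    · exact ⟨_, _, u, .pass i q, forall_intCast_eq_add_zero.2 rfl, rfl⟩
    · exact ⟨_, _, v, .refute i q, forall_intCast_eq_add_neg_single.2 hv, rfl⟩

theorem step_goal (u : Fin d → ℕ) :
    (M.toVASSMDP e).toMDP.Step (e goal, u) (e goal, u) :=
  toVASSMDP_step_iff.2 ⟨_, _, u, .stay, forall_intCast_eq_add_zero.2 rfl, rfl⟩

theorem deadlock_trap (u : Fin d → ℕ) : (M.toVASSMDP e).toMDP.Deadlock (e trap, u) := by
  rintro ⟨c, hc⟩
  obtain ⟨z, b, v, hz, -⟩ := toVASSMDP_step_iff.1 hc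
  nomatch hz

theorem safeStep_of_step {a : Control d Q} {u : Fin d → ℕ} {c : VASSConfig d (Fin (k + 1))}
    (ha : ∀ i q, a ≠ check i q) (h : (M.toVASSMDP e).toMDP.Step (e a, u) c) :
    (M.toVASSMDP e).toMDP.SafeStep (e a, u) c :=
  ⟨h, fun h' => absurd (mem_player1_iff.2 ha) h'⟩

theorem safeStep_check {i : Fin d} {q : Q} {u : Fin d → ℕ} (hu : u i = 0) :
    (M.toVASSMDP e).toMDP.SafeStep (e (check i q), u) (e (node q), u) := by
  refine ⟨step_check_iff.2 (.inl rfl), fun _ b hb => ?_⟩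
  obtain rfl | ⟨v, hv, -⟩ := step_check_iff.1 hb
  · rfl
  · simp [show u = v + Pi.single i 1 from hv] at hu

theorem reflTransGen_safeStep_of_rel (q : Q) {x : CounterAction (Fin d)} {u v : Fin d → ℕ}
    (h : x.Rel u v) : Relation.ReflTransGen (M.toVASSMDP e).toMDP.SafeStep
      (e (node q), u) (e (node (M.step q x)), v) := by
  cases x with
  | inc i => exact .single (safeStep_of_step nofun (step_node_iff.2 (.inl ⟨i, v, h, rfl⟩)))
  | dec i =>
    exact .single (safeStep_of_step nofun (step_node_iff.2 (.inr (.inl ⟨i, v, h, rfl⟩))))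
  | test i =>
    obtain ⟨hu, rfl⟩ := h
    exact .head (safeStep_of_step nofun (step_node_iff.2 (.inr (.inr (.inl ⟨i, rfl⟩)))))
      (.single (safeStep_check hu))

theorem reflTransGen_safeStep_of_run (q : Q) {w : List (CounterAction (Fin d))}
    {u v : Fin d → ℕ} (h : CounterAction.Run w u v) :
    Relation.ReflTransGen (M.toVASSMDP e).toMDP.SafeStep
      (e (node q), u) (e (node (M.evalFrom q w)), v) := by
  induction w generalizing q u with
  | nil => exact (show u = v from h) ▸ .refl
  | cons x w ih =>
    obtain ⟨m, hx, hw⟩ := h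
    exact (reflTransGen_safeStep_of_rel q hx).trans (ih (M.step q x) hw)

theorem surely_repeatedReach_goal {u v : Fin d → ℕ} (h : CounterAction.RunOf M.accepts u v) :
    (M.toVASSMDP e).toMDP.Surely (e (node M.start), u)
      (MDP.repeatedReach {c | c.1 = e goal}) := by
  obtain ⟨w, hw, h⟩ := h
  have haccept : (M.toVASSMDP e).toMDP.SafeStep (e (node (M.evalFrom M.start w)), v)
      (e goal, v) := safeStep_of_step nofun (step_node_iff.2 (.inr (.inr (.inr ⟨hw, rfl⟩))))
  exact MDP.surely_repeatedReach_of_reflTransGen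
    ((reflTransGen_safeStep_of_run M.start h).tail haccept)
    (safeStep_of_step nofun (step_goal v)) rfl

/-- The configurations at nodes, or at checks of true claims, whose automaton state and counter
values form a pair in `I`. -/
def honest (e : Control d Q ≃ Fin (k + 1)) (I : Set (Q × (Fin d → ℕ))) :
    Set (VASSConfig d (Fin (k + 1))) :=
  {c | (∃ q, c.1 = e (node q) ∧ (q, c.2) ∈ I) ∨
    ∃ i q, c.1 = e (check i q) ∧ c.2 i = 0 ∧ (q, c.2) ∈ I}

/-- The configurations at checks of false claims: the probabilistic player can refute these. -/
def cheating (e : Control d Q ≃ Fin (k + 1)) : Set (VASSConfig d (Fin (k + 1))) :=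
  {c | ∃ i q, c.1 = e (check i q) ∧ c.2 i ≠ 0}

theorem mem_honest_union_cheating_of_step {I : Set (Q × (Fin d → ℕ))}
    (hI : ∀ a ∈ I, ∀ x v, x.Rel a.2 v → (M.step a.1 x, v) ∈ I) (hacc : ∀ a ∈ I, a.1 ∉ M.accept)
    {c b : VASSConfig d (Fin (k + 1))} (hc : c ∈ honest e I)
    (h : (M.toVASSMDP e).toMDP.Step c b) : b ∈ honest e I ∪ cheating e := by
  obtain ⟨_, u⟩ := c
  obtain ⟨q, rfl, hq⟩ | ⟨i, q, rfl, hu, hq⟩ := hc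
  · obtain ⟨i, v, hv, rfl⟩ | ⟨i, v, hv, rfl⟩ | ⟨i, rfl⟩ | ⟨ha, -⟩ := step_node_iff.1 h
    · exact .inl (.inl ⟨_, rfl, hI _ hq _ v hv⟩)
    · exact .inl (.inl ⟨_, rfl, hI _ hq _ v hv⟩)
    · by_cases hu : u i = 0
      · exact .inl (.inr ⟨i, _, rfl, hu, hI _ hq (.test i) u ⟨hu, rfl⟩⟩)
      · exact .inr ⟨i, _, rfl, hu⟩
    · exact absurd ha (hacc _ hq)
  · obtain rfl | ⟨v, hv, -⟩ := step_check_iff.1 h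
    · exact .inl (.inl ⟨q, rfl, hq⟩)
    · simp [show u = v + Pi.single i 1 from hv] at hu

theorem exists_step_trap_of_mem_cheating {c : VASSConfig d (Fin (k + 1))}
    (hc : c ∈ cheating e) : ∃ v, (M.toVASSMDP e).toMDP.Step c (e trap, v) := by
  obtain ⟨_, u⟩ := c
  obtain ⟨i, q, rfl, hu⟩ := hc
  refine ⟨u - Pi.single i 1, step_check_iff.2 (.inr ⟨_, ?_, rfl⟩)⟩
  exact (tsub_add_cancel_of_le (update_le_iff.2
    ⟨Nat.one_le_iff_ne_zero.2 hu, fun _ _ => Nat.zero_le _⟩)).symm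

omit [Finite Q] in
theorem disjoint_honest_cheating (I : Set (Q × (Fin d → ℕ))) :
    Disjoint (honest e I) (cheating e) := by
  refine Set.disjoint_left.2 ?_
  rintro ⟨_, u⟩ (⟨q, rfl, -⟩ | ⟨i, q, rfl, hu, -⟩) ⟨j, q', h, hu'⟩
  · nomatch e.injective h
  · cases e.injective h
    exact hu' hu

theorem playMeasure_reach_goal_le {I : Set (Q × (Fin d → ℕ))}
    (hI : ∀ a ∈ I, ∀ x v, x.Rel a.2 v → (M.step a.1 x, v) ∈ I) (hacc : ∀ a ∈ I, a.1 ∉ M.accept)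
    (σ : (M.toVASSMDP e).toMDP.Strategy) {q : Q} {u : Fin d → ℕ} (h : (q, u) ∈ I) :
    MDP.playMeasure σ (e (node q), u) (MDP.reach {c | c.1 = e goal}) ≤
      1 - ((M.toVASSMDP e).T.card : ENNReal)⁻¹ := by
  refine MDP.playMeasure_reach_le (good := honest e I) (bad := cheating e)
    (trap := {c | c.1 = e trap}) ?_ ?_ ?_ (disjoint_honest_cheating I) ?_ ?_ ?_ σ
    (.inl ⟨q, rfl, h⟩)
  · exact fun c hc b hb => mem_honest_union_cheating_of_step hI hacc hc hb
  · intro c hc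
    obtain ⟨v, hv⟩ := exists_step_trap_of_mem_cheating (M := M) hc
    have hp : c ∉ (M.toVASSMDP e).toMDP.player1 := by
      obtain ⟨i, q, hc, -⟩ := hc
      exact fun h => h i q hc
    exact ⟨⟨hp, _, hv⟩, _, rfl, VASSMDP.inv_card_le_stepProb (fun _ => rfl) hv⟩
  · rintro ⟨_, u⟩ rfl
    exact deadlock_trap u
  · refine Set.disjoint_left.2 ?_
    rintro ⟨_, u⟩ (⟨q, rfl, -⟩ | ⟨i, q, rfl, -⟩) h <;> nomatch e.injective h
  · refine Set.disjoint_left.2 ?_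
    rintro ⟨_, u⟩ ⟨i, q, rfl, -⟩ h
    nomatch e.injective h
  · refine Set.disjoint_left.2 ?_
    rintro ⟨_, u⟩ rfl h
    nomatch e.injective h

theorem exists_runOf_of_limitSurely_reach_goal {u : Fin d → ℕ}
    (h : (M.toVASSMDP e).toMDP.LimitSurely (e (node M.start), u)
      (MDP.reach {c | c.1 = e goal})) : ∃ v, CounterAction.RunOf M.accepts u v := by
  by_contra! hno
  let I : Set (Q × (Fin d → ℕ)) := {a | ∃ w, M.eval w = a.1 ∧ CounterAction.Run w u a.2}
  have hI : ∀ a ∈ I, ∀ x v, x.Rel a.2 v → (M.step a.1 x, v) ∈ I := by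
    rintro ⟨_, m⟩ ⟨w, rfl, hw⟩ x v hx
    refine ⟨w ++ [x], M.eval_append_singleton w x, ?_⟩
    rw [CounterAction.run_append]
    exact ⟨m, hw, v, hx, rfl⟩
  have hacc : ∀ a ∈ I, a.1 ∉ M.accept := by
    rintro ⟨_, v⟩ ⟨w, rfl, hw⟩ ha
    exact hno v ⟨w, ha, hw⟩
  have hle : (1 : ENNReal) ≤ 1 - ((M.toVASSMDP e).T.card : ENNReal)⁻¹ :=
    h.symm.le.trans (iSup_le fun σ => playMeasure_reach_goal_le hI hacc σ ⟨[], rfl, rfl⟩)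
  refine not_lt.2 hle (ENNReal.sub_lt_self ENNReal.one_ne_top one_ne_zero ?_)
  exact ENNReal.inv_ne_zero.2 (ENNReal.natCast_ne_top _)

end CounterAutomaton

end CounterAutomata

section Undecidability

theorem exists_vassInput_of_counterDefinable {d : ℕ} {R : (Fin d → ℕ) → (Fin d → ℕ) → Prop}
    (hR : CounterDefinable R) : ∃ (k : ℕ) (S : VASSMDP d (Fin (k + 1))) (q t : Fin (k + 1)), ∀ u,
      ((∃ v, R u v) → VASSInput.SureRepeatedReachability ⟨k, S, (q, u), t⟩) ∧
      (VASSInput.LimitSureReachability ⟨k, S, (q, u), t⟩ → ∃ v, R u v) := by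
  obtain ⟨L, ⟨Q, _, M, rfl⟩, rfl⟩ := hR.exists_isRegular
  obtain ⟨m, ⟨e⟩⟩ := Finite.exists_equiv_fin (CounterAutomaton.Control d Q)
  obtain ⟨k, rfl⟩ := Nat.exists_eq_succ_of_ne_zero (e .goal).pos.ne'
  exact ⟨k, CounterAutomaton.toVASSMDP M e, e (.node M.start), e .goal, fun u =>
    ⟨fun ⟨_, h⟩ => CounterAutomaton.surely_repeatedReach_goal h,
      CounterAutomaton.exists_runOf_of_limitSurely_reach_goal⟩⟩

/-- The code `c` with the initial counter values replaced by those in the list `v`. -/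
def VASSCode.withCounters (c : VASSCode) (v : List ℕ) : VASSCode :=
  (c.1, c.2.1, c.2.2.1, (c.2.2.2.1.1, v), c.2.2.2.2)

theorem VASSCode.primrec_withCounters (c : VASSCode) : Primrec c.withCounters :=
  .pair (.const _) (.pair (.const _) (.pair (.const _)
    (.pair (.pair (.const _) .id) (.const _))))

theorem VASSCode.exists_decode_withCounters {d k : ℕ} (S : VASSMDP d (Fin (k + 1)))
    (q t : Fin (k + 1)) : ∃ c : VASSCode, ∀ v : List ℕ,
      decode d (c.withCounters v) = ⟨k, S, (q, fun i => v.getD i 0), t⟩ := by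
  obtain ⟨⟨k', O, L, ⟨q', w⟩, t'⟩, h⟩ := decode_surjective d ⟨k, S, (q, 0), t⟩
  refine ⟨(k', O, L, (q', w), t'), fun v => ?_⟩
  simp only [decode, VASSInput.mk.injEq] at h
  obtain ⟨rfl, hS, hq, ht⟩ := h
  simp only [heq_eq_eq, Prod.mk.injEq] at hS hq ht
  obtain ⟨rfl, rfl, rfl⟩ := And.intro hS (And.intro hq.1 ht)
  rfl

theorem exists_computable_vassCode {f : ℕ →. ℕ} (hf : Partrec f) :
    ∃ code : ℕ → VASSCode, Computable code ∧ ∀ n,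
      ((f n).Dom → (VASSCode.decode 2 (code n)).SureRepeatedReachability) ∧
      ((VASSCode.decode 2 (code n)).LimitSureReachability → (f n).Dom) := by
  obtain ⟨R, hR, g, hg, hRf⟩ := exists_counterDefinable_dom_iff hf
  obtain ⟨k, S, q, t, hS⟩ := exists_vassInput_of_counterDefinable hR
  obtain ⟨c, hc⟩ := VASSCode.exists_decode_withCounters S q t
  refine ⟨fun n => c.withCounters [g n, 0], c.primrec_withCounters.to_comp.comp
    (Computable.list_cons.comp hg (.const [0])), fun n => ?_⟩
  have hcounters : (fun i : Fin 2 => [g n, 0].getD i 0) = ![g n, 0] := by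
    funext i
    fin_cases i <;> rfl
  rw [hc, hcounters, ← hRf n]
  exact hS _

theorem undecidableInDim_two {P : VASSInput 2 → Prop}
    (hsure : ∀ I, I.SureRepeatedReachability → P I)
    (hlimit : ∀ I, P I → I.LimitSureReachability) : UndecidableInDim 2 P := by
  intro hP
  obtain ⟨code, hcode, h⟩ := exists_computable_vassCode
    (f := fun n => (Denumerable.ofNat Nat.Partrec.Code n).eval 0)
    (Nat.Partrec.Code.eval_part.comp (Computable.ofNat _) (Computable.const 0))
  refine ComputablePred.halting_problem 0 (ComputablePred.computable_of_manyOneReducible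
    ⟨_, hcode.comp Computable.encode, fun c => ?_⟩ hP)
  have hc := h (Encodable.encode c)
  rw [Denumerable.ofNat_encode] at hc
  exact ⟨fun hdom => hsure _ (hc.1 hdom), fun hPc => hc.2 (hlimit _ hPc)⟩

theorem undecidableVASSProblem_of_undecidableInDim (d : ℕ) {P : ∀ d, VASSInput d → Prop}
    (h : UndecidableInDim d (P d)) : UndecidableVASSProblem P := fun hP =>
  h (ComputablePred.computable_of_manyOneReducible
    ⟨fun c => (d, c), Computable.pair (Computable.const d) Computable.id, fun _ => Iff.rfl⟩ hP)

end Undecidability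

section Objectives

variable {d : ℕ} {I : VASSInput d}

theorem VASSInput.SureReachability.almostSureReachability (h : I.SureReachability) :
    I.AlmostSureReachability := MDP.Surely.almostSurely h

theorem VASSInput.AlmostSureReachability.limitSureReachability (h : I.AlmostSureReachability) :
    I.LimitSureReachability := MDP.AlmostSurely.limitSurely h

theorem VASSInput.SureRepeatedReachability.almostSureRepeatedReachability
    (h : I.SureRepeatedReachability) : I.AlmostSureRepeatedReachability :=
  MDP.Surely.almostSurely h

theorem VASSInput.AlmostSureRepeatedReachability.limitSureRepeatedReachability
    (h : I.AlmostSureRepeatedReachability) : I.LimitSureRepeatedReachability :=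
  MDP.AlmostSurely.limitSurely h

theorem VASSInput.SureRepeatedReachability.sureReachability (h : I.SureRepeatedReachability) :
    I.SureReachability := MDP.Surely.mono (MDP.repeatedReach_subset_reach _) h

theorem VASSInput.LimitSureRepeatedReachability.limitSureReachability
    (h : I.LimitSureRepeatedReachability) : I.LimitSureReachability :=
  MDP.LimitSurely.mono (MDP.repeatedReach_subset_reach _) h

end Objectives

theorem mainTheorem8 :
    (UndecidableVASSProblem (fun d => VASSInput.SureReachability (d := d)) ∧
      UndecidableVASSProblem (fun d => VASSInput.AlmostSureReachability (d := d)) ∧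
      UndecidableVASSProblem (fun d => VASSInput.LimitSureReachability (d := d)) ∧
      UndecidableVASSProblem (fun d => VASSInput.SureRepeatedReachability (d := d)) ∧
      UndecidableVASSProblem (fun d => VASSInput.AlmostSureRepeatedReachability (d := d)) ∧
      UndecidableVASSProblem (fun d => VASSInput.LimitSureRepeatedReachability (d := d))) ∧
    (UndecidableInDim 2 VASSInput.SureReachability ∧
      UndecidableInDim 2 VASSInput.AlmostSureReachability ∧
      UndecidableInDim 2 VASSInput.LimitSureReachability ∧
      UndecidableInDim 2 VASSInput.SureRepeatedReachability ∧
      UndecidableInDim 2 VASSInput.AlmostSureRepeatedReachability ∧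
      UndecidableInDim 2 VASSInput.LimitSureRepeatedReachability) := by
  have h1 : UndecidableInDim 2 VASSInput.SureReachability :=
    undecidableInDim_two (fun _ h => h.sureReachability)
      fun _ h => h.almostSureReachability.limitSureReachability
  have h2 : UndecidableInDim 2 VASSInput.AlmostSureReachability :=
    undecidableInDim_two (fun _ h => h.sureReachability.almostSureReachability)
      fun _ h => h.limitSureReachability
  have h3 : UndecidableInDim 2 VASSInput.LimitSureReachability :=
    undecidableInDim_two
      (fun _ h => h.sureReachability.almostSureReachability.limitSureReachability) fun _ h => h
  have h4 : UndecidableInDim 2 VASSInput.SureRepeatedReachability :=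
    undecidableInDim_two (fun _ h => h)
      fun _ h => h.sureReachability.almostSureReachability.limitSureReachability
  have h5 : UndecidableInDim 2 VASSInput.AlmostSureRepeatedReachability :=
    undecidableInDim_two (fun _ h => h.almostSureRepeatedReachability)
      fun _ h => h.limitSureRepeatedReachability.limitSureReachability
  have h6 : UndecidableInDim 2 VASSInput.LimitSureRepeatedReachability :=
    undecidableInDim_two
      (fun _ h => h.almostSureRepeatedReachability.limitSureRepeatedReachability)
      fun _ h => h.limitSureReachability
  have hdim : ∀ {P : ∀ d, VASSInput d → Prop}, UndecidableInDim 2 (P 2) →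
      UndecidableVASSProblem P := undecidableVASSProblem_of_undecidableInDim 2
  exact ⟨⟨hdim h1, hdim h2, hdim h3, hdim h4, hdim h5, hdim h6⟩, h1, h2, h3, h4, h5, h6⟩
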